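/- Let $q\in L^1(\mathbb R_+)$, $\mathbb R_+=(0,\infty)$, be complex-valued, let $\alpha\in\mathbb C\cup\{\infty\}$, and put $$\epsilon=\begin{pmatrix}0&1\\1&0\end{pmatrix},\quad Q=\begin{pmatrix}0&q\\\overline q&0\end{pmatrix},\quad A=\begin{pmatrix}\overline\alpha&0\\0&\alpha\end{pmatrix}\ (\alpha\ne\infty),\quad P_\pm=\frac12\begin{pmatrix}1&\pm1\\\pm1&1\end{pmatrix}.$$ For $F$ on $[0,\infty)$ put $$L_\alpha(F)=\frac{\overline A F'(0)-F(0)}{\sqrt{1+|\alpha|^2}},\quad L_\alpha^\perp(F)=\frac{F'(0)+AF(0)}{\sqrt{1+|\alpha|^2}}\quad(\alpha\neq\infty),\qquad L_\infty(F)=F'(0),\quad L_\infty^\perp(F)=F(0).$$ For $\lambda\in\mathbb C$ let $\Phi,\Theta$ be the $2\times2$ matrix solutions of $-\epsilon F''+QF=\lambda F$ on $\mathbb R_+$ ($F,F'$ locally absolutely continuous on $[0,\infty)$, equation a.e.) with $$L_\alpha(\Phi)=-I,\quad L_\alpha^\perp(\Phi)=0,\qquad L_\alpha(\Theta)=0,\quad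 L_\alpha^\perp(\Theta)=\epsilon .$$ For $\lambda\in\mathbb C\setminus\mathbb R$ the $M$-function $M_\alpha(\lambda)$ is the unique $2\times2$ matrix such that both columns of $\Theta-\Phi M_\alpha(\lambda)$ belong to $L^2(\mathbb R_+;\mathbb C^2)$; for real $\lambda$, $M_\alpha(\lambda)$ denotes the boundary value $M_\alpha(\lambda+\mathrm i0)$, the limit from the open upper half-plane. Then, for all $k$ of sufficiently large modulus (depending on $q$ and $\alpha$) with $0\le\arg k\le\pi/4$, the matrix $M_\alpha(k^2)$ is well defined: if $0<\arg k\le\pi/4$, there is exactly one matrix with the stated property, and if $\arg k=0$, the boundary value exists. Moreover, as $|k|\to\infty$ in the sector $0\le\arg k\le\pi/4$ (uniformly in $\arg k$, hence in particular along every ray in it), $$M_\alpha(k^2)=\epsilon A+\frac{1+|\alpha|^2}{k}(\mathrm iP_+-P_-)+\frac{1+|\alpha|^2}{k^2}(\mathrm iP_+-P_-)\,\epsilon A\,(\mathrm iP_+-P_-)+o(1/k^2)$$ if $\alpha\neq\infty$, and $$M_\infty(k^2)=k(\mathrm iP_++P_-)+o(1)$$ if $\alpha=\infty$. -/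

import Mathlib

open MeasureTheory Filter Topology Asymptotics Matrix
open scoped OnePoint ComplexConjugate

noncomputable section

namespace HermitisedSchrodinger

/-- The Pauli matrix `ε`. -/
def eps : Matrix (Fin 2) (Fin 2) ℂ := !![0, 1; 1, 0]

/-- The orthogonal projection of `ℂ²` onto the span of `(1, 1)`. -/
def Pplus : Matrix (Fin 2) (Fin 2) ℂ := (1 / 2 : ℂ) • !![1, 1; 1, 1]

/-- The orthogonal projection of `ℂ²` onto the span of `(1, -1)`. -/
def Pminus : Matrix (Fin 2) (Fin 2) ℂ := (1 / 2 : ℂ) • !![1, -1; -1, 1]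

/-- The matrix potential `Q(x)` built from the scalar potential `q`. -/
def potential (q : ℝ → ℂ) (x : ℝ) : Matrix (Fin 2) (Fin 2) ℂ := !![0, q x; conj (q x), 0]

/-- The boundary matrix `A = diag(conj α, α)`, for finite `α`. -/
def bdryMatrix (α : ℂ) : Matrix (Fin 2) (Fin 2) ℂ := !![conj α, 0; 0, α]

/-- The derivative of a function on the half-line `[0, ∞)`; at `0` it is one-sided. -/
def dHalf (F : ℝ → Fin 2 → ℂ) : ℝ → Fin 2 → ℂ := derivWithin F (Set.Ici 0)

/-- `F` is a solution on the half-line of `-ε F'' + Q F = lam F`: the functions `F` and `F'` are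
absolutely continuous on every interval `[0, b]`, and the equation holds almost everywhere. -/
structure IsSolution (q : ℝ → ℂ) (lam : ℂ) (F : ℝ → Fin 2 → ℂ) : Prop where
  differentiable : DifferentiableOn ℝ F (Set.Ici 0)
  absCont : ∀ b : ℝ, 0 < b → AbsolutelyContinuousOnInterval F 0 b
  absCont_deriv : ∀ b : ℝ, 0 < b → AbsolutelyContinuousOnInterval (dHalf F) 0 b
  equation : ∀ᵐ x ∂(volume.restrict (Set.Ioi (0 : ℝ))), ∃ F₂ : Fin 2 → ℂ,
    HasDerivAt (dHalf F) F₂ x ∧ -(eps *ᵥ F₂) + potential q x *ᵥ F x = lam • F x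

/-- The boundary operator `L_α`; for `α ≠ ∞` it is `(conj A F'(0) - F(0)) / √(1 + |α|²)`
and for `α = ∞` it is `F'(0)`. -/
def bdryL (α : OnePoint ℂ) (F : ℝ → Fin 2 → ℂ) : Fin 2 → ℂ :=
  α.elim (dHalf F 0) fun a =>
    (√(1 + ‖a‖ ^ 2))⁻¹ • ((bdryMatrix a).map conj *ᵥ dHalf F 0 - F 0)

/-- The boundary operator `L_α^⊥`; for `α ≠ ∞` it is `(F'(0) + A F(0)) / √(1 + |α|²)`
and for `α = ∞` it is `F(0)`. -/
def bdryLperp (α : OnePoint ℂ) (F : ℝ → Fin 2 → ℂ) : Fin 2 → ℂ :=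
  α.elim (F 0) fun a =>
    (√(1 + ‖a‖ ^ 2))⁻¹ • (dHalf F 0 + bdryMatrix a *ᵥ F 0)

/-- The `j`-th column of a matrix-valued function. -/
def colFun (Y : ℝ → Matrix (Fin 2) (Fin 2) ℂ) (j : Fin 2) : ℝ → Fin 2 → ℂ := fun x => (Y x).col j

/-- `Φ` is the regular matrix solution with `L_α(Φ) = -I`, `L_α^⊥(Φ) = 0`. -/
def IsPhi (q : ℝ → ℂ) (α : OnePoint ℂ) (lam : ℂ) (Phi : ℝ → Matrix (Fin 2) (Fin 2) ℂ) : Prop :=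
  ∀ j, IsSolution q lam (colFun Phi j) ∧
    bdryL α (colFun Phi j) = (-1 : Matrix (Fin 2) (Fin 2) ℂ).col j ∧
    bdryLperp α (colFun Phi j) = 0

/-- `Θ` is the regular matrix solution with `L_α(Θ) = 0`, `L_α^⊥(Θ) = ε`. -/
def IsTheta (q : ℝ → ℂ) (α : OnePoint ℂ) (lam : ℂ) (Theta : ℝ → Matrix (Fin 2) (Fin 2) ℂ) : Prop :=
  ∀ j, IsSolution q lam (colFun Theta j) ∧
    bdryL α (colFun Theta j) = 0 ∧
    bdryLperp α (colFun Theta j) = eps.col j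

/-- `M` is a Titchmarsh–Weyl matrix at `lam`: both columns of `X = Θ - Φ M` are square
integrable on the half-line. (`Φ` and `Θ` are determined on `[0, ∞)` by their Cauchy data.) -/
def IsWeylMatrix (q : ℝ → ℂ) (α : OnePoint ℂ) (lam : ℂ) (M : Matrix (Fin 2) (Fin 2) ℂ) : Prop :=
  ∃ Phi Theta : ℝ → Matrix (Fin 2) (Fin 2) ℂ, IsPhi q α lam Phi ∧ IsTheta q α lam Theta ∧
    ∀ j, MemLp (colFun (fun x => Theta x - Phi x * M) j) 2 (volume.restrict (Set.Ioi (0 : ℝ)))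

/-- The Titchmarsh–Weyl matrix at a non-real point. -/
def weylMatrix (q : ℝ → ℂ) (α : OnePoint ℂ) (lam : ℂ) : Matrix (Fin 2) (Fin 2) ℂ :=
  Classical.epsilon (IsWeylMatrix q α lam)

/-- The `M`-function: the Titchmarsh–Weyl matrix off the real axis, and on the real axis the
boundary value `M_α(lam + i0)`, the limit from the open upper half-plane. -/
def mFunction (q : ℝ → ℂ) (α : OnePoint ℂ) (lam : ℂ) : Matrix (Fin 2) (Fin 2) ℂ :=
  open Classical in
  if lam.im = 0 then limUnder (𝓝[{z : ℂ | 0 < z.im}] lam) (weylMatrix q α)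
  else weylMatrix q α lam

/-- The closed sector `0 ≤ arg k ≤ π/4`. -/
def closedSector : Set ℂ := {k : ℂ | 0 ≤ k.arg ∧ k.arg ≤ Real.pi / 4}

/-- `|k| → ∞` within the closed sector `0 ≤ arg k ≤ π/4`. -/
def sectorAtInfinity : Filter ℂ := Bornology.cobounded ℂ ⊓ 𝓟 closedSector

/-- The matrix `i P₊ - P₋`. -/
def T : Matrix (Fin 2) (Fin 2) ℂ := Complex.I • Pplus - Pminus

/-- The explicit part of the expansion of `M_α(k²)` for finite `α`. -/
def expansion (α : ℂ) (k : ℂ) : Matrix (Fin 2) (Fin 2) ℂ :=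
  eps * bdryMatrix α + ((1 + (‖α‖ : ℂ) ^ 2) / k) • T
    + ((1 + (‖α‖ : ℂ) ^ 2) / k ^ 2) • (T * (eps * bdryMatrix α) * T)

end HermitisedSchrodinger

end

/-! Since `ε² = 1`, the equation with `λ = k²` reads `F'' = εQF - k²εF`. As `ε` is `1` on the range
of `P₊` and `-1` on that of `P₋`, the free equation splits into `u'' = (ik)²u` and `u'' = k²u`. On
the closed first quadrant both rates `ik` and `-k` have nonpositive real part, so `e^{kTx}c` with `T
= iP₊ - P₋` is the free solution that is bounded, and decays when `k` is interior.

For `|k| ≥ radius q` the Jost integral equation, with the Dirichlet Green kernel of size `1/|k|`, is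
a contraction. It gives bounded solutions with value `c` at `0`, jointly continuous in `(k, x)` up
to the real axis (`exists_isJost`). Their derivative at `0` is `kTc - J`, where `J` is a
Laplace-type integral of `εQF`; it tends to `0` by a Riemann–Lebesgue lemma uniform in the left
half-plane (`IsJost.tendsto_jostCorr`).

For interior `k` the Jost solutions are square integrable. Every square integrable solution has zero
bilinear Wronskian with them (`IsSolution.wronskian_eq_zero`), so the relation `F'(0) = mF(0)`, with
`m = kT + r(k)` and `r → 0`, characterises the initial data of square integrable solutions
(`exists_isDirichletToNeumann`).

The rest is linear algebra: the boundary conditions give the Weyl matrix as an explicit function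
`weylForm` of `m` (`IsDirichletToNeumann.isWeylMatrix_iff_eq`), and this function is expanded using
`T² = -ε`. Because `r` is continuous up to the real axis, the boundary value on `arg k = 0` is given
by the same formula, so one limit covers the whole sector uniformly. -/

noncomputable section

namespace HermitisedSchrodinger

/-! ### Variation of constants for `u'' = β²u + h` with locally integrable `h`. -/

section Duhamel

theorem _root_.MeasureTheory.LocallyIntegrable.intervalIntegrable_of_real {E : Type*}
    [NormedAddCommGroup E] {h : ℝ → E} (hh : LocallyIntegrable h) (a b : ℝ) :
    IntervalIntegrable h volume a b :=
  intervalIntegrable_iff.mpr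
    ((hh.integrableOn_isCompact isCompact_uIcc).mono_set Set.uIoc_subset_uIcc)

theorem absolutelyContinuousOnInterval_const {E : Type*} [NormedAddCommGroup E] (c : E) (a b : ℝ) :
    AbsolutelyContinuousOnInterval (fun _ => c) a b := by
  simpa [AbsolutelyContinuousOnInterval] using tendsto_const_nhds

variable {E : Type*} [NormedAddCommGroup E] [NormedSpace ℂ E]

/-- The increments of the primitive are dominated by those of the scalar primitive of `‖h‖`, so
absolute continuity passes from the scalar case to values in `E`. -/
theorem _root_.MeasureTheory.LocallyIntegrable.absolutelyContinuousOnInterval_integral {h : ℝ → E}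
    (hh : LocallyIntegrable h) (a b c : ℝ) :
    AbsolutelyContinuousOnInterval (fun x => ∫ t in c..x, h t) a b := by
  have hi := fun u v => hh.intervalIntegrable_of_real u v
  have hni := fun u v => (hi u v).norm
  have hac := (hni a b).absolutelyContinuousOnInterval_intervalIntegral
    (c := a) Set.left_mem_uIcc
  refine squeeze_zero (fun t => Finset.sum_nonneg fun i _ => dist_nonneg) (fun t => ?_) hac
  refine Finset.sum_le_sum fun i _ => ?_
  rw [dist_eq_norm, dist_eq_norm, intervalIntegral.integral_interval_sub_left (hi _ _) (hi _ _),
    intervalIntegral.integral_interval_sub_left (hni _ _) (hni _ _)]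
  exact intervalIntegral.norm_integral_le_abs_integral_norm

theorem _root_.MeasureTheory.LocallyIntegrable.continuous_integral {h : ℝ → E}
    (hh : LocallyIntegrable h) (c : ℝ) : Continuous (fun x => ∫ t in c..x, h t) :=
  intervalIntegral.continuous_primitive (fun a b => hh.intervalIntegrable_of_real a b) c

/-- The solution of `w' = β w + h`, `w(0) = c`. -/
def expConv (β : ℂ) (c : E) (h : ℝ → E) (x : ℝ) : E :=
  Complex.exp (β * x) • (c + ∫ y in (0 : ℝ)..x, Complex.exp (-β * y) • h y)

theorem continuous_cexp_mul (β : ℂ) : Continuous fun x : ℝ => Complex.exp (β * x) := by fun_prop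

theorem hasDerivAt_cexp_mul (β : ℂ) (x : ℝ) :
    HasDerivAt (fun x : ℝ => Complex.exp (β * x)) (β * Complex.exp (β * x)) x := by
  have := ((hasDerivAt_id (x : ℂ)).const_mul β).cexp.comp_ofReal
  simpa [mul_comm] using this

theorem continuous_expConv (β : ℂ) (c : E) {h : ℝ → E} (hh : LocallyIntegrable h) :
    Continuous (expConv β c h) :=
  (continuous_cexp_mul β).smul
    (continuous_const.add ((hh.continuous_smul (continuous_cexp_mul (-β))).continuous_integral 0))

theorem expConv_zero (β : ℂ) (c : E) (h : ℝ → E) : expConv β c h 0 = c := by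
  simp [expConv]

/-- The general solution of `u'' = β² u + h`. -/
def duhamel (β : ℂ) (c₁ c₂ : E) (h : ℝ → E) (x : ℝ) : E :=
  (2 * β)⁻¹ • (expConv β c₁ h x - expConv (-β) c₂ h x)

/-- The derivative of `duhamel`. -/
def duhamelDeriv (β : ℂ) (c₁ c₂ : E) (h : ℝ → E) (x : ℝ) : E :=
  (2⁻¹ : ℂ) • (expConv β c₁ h x + expConv (-β) c₂ h x)

theorem continuous_duhamel (β : ℂ) (c₁ c₂ : E) {h : ℝ → E} (hh : LocallyIntegrable h) :
    Continuous (duhamel β c₁ c₂ h) :=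
  ((continuous_expConv β c₁ hh).sub (continuous_expConv (-β) c₂ hh)).const_smul _

theorem continuous_duhamelDeriv (β : ℂ) (c₁ c₂ : E) {h : ℝ → E} (hh : LocallyIntegrable h) :
    Continuous (duhamelDeriv β c₁ c₂ h) :=
  ((continuous_expConv β c₁ hh).add (continuous_expConv (-β) c₂ hh)).const_smul _

variable [CompleteSpace E]

/-- As `h` is only locally integrable, the equation `w' = βw + h` holds only almost everywhere. The
difference of the two sides is absolutely continuous with derivative zero almost everywhere, hence
constant. -/
theorem expConv_eq_integral (β : ℂ) (c : E) {h : ℝ → E} (hh : LocallyIntegrable h) (x : ℝ) :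
    expConv β c h x = c + ∫ t in (0 : ℝ)..x, (β • expConv β c h t + h t) := by
  have hsm := hh.continuous_smul (continuous_cexp_mul (-β))
  have hr : LocallyIntegrable fun t => β • expConv β c h t + h t :=
    ((continuous_expConv β c hh).const_smul β).locallyIntegrable.add hh
  have hexp : AbsolutelyContinuousOnInterval (fun x : ℝ => Complex.exp (β * x)) 0 x := by
    refine ContDiffOn.absolutelyContinuousOnInterval (ContDiff.contDiffOn ?_)
    exact (contDiff_const.mul Complex.ofRealCLM.contDiff).cexp
  have hac : AbsolutelyContinuousOnInterval
      (fun x => expConv β c h x - ∫ t in (0 : ℝ)..x, (β • expConv β c h t + h t)) 0 x :=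
    (hexp.fun_smul ((absolutelyContinuousOnInterval_const c 0 x).fun_add
      (hsm.absolutelyContinuousOnInterval_integral 0 x 0))).fun_sub
      (hr.absolutelyContinuousOnInterval_integral 0 x 0)
  obtain ⟨C, hC⟩ := hac.const_of_ae_hasDerivAt_zero (by
    filter_upwards [LocallyIntegrable.ae_hasDerivAt_integral hsm,
      LocallyIntegrable.ae_hasDerivAt_integral hr] with t h1 h2 _
    have := ((hasDerivAt_cexp_mul β t).smul ((h1 0).const_add c)).sub (h2 0)
    convert! this using 1
    rw [smul_smul, ← Complex.exp_add]
    simp only [expConv, neg_mul, add_neg_cancel, Complex.exp_zero, one_smul, smul_add, mul_smul]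
    abel)
  have h0 := hC 0 Set.left_mem_uIcc
  have hx := hC x Set.right_mem_uIcc
  simp only [expConv_zero, intervalIntegral.integral_same, sub_zero] at h0
  rw [← sub_eq_iff_eq_add, hx, h0]

/-- The two `expConv` terms are `u' + βu` and `u' - βu`, with initial values `c₁` and `c₂`. In the
derivative of their difference `h` cancels, so `u` is differentiable at every point with continuous
derivative; only `u'` is merely absolutely continuous. -/
theorem hasDerivAt_duhamel {β : ℂ} (hβ : β ≠ 0) (c₁ c₂ : E) {h : ℝ → E}
    (hh : LocallyIntegrable h) (x : ℝ) :
    HasDerivAt (duhamel β c₁ c₂ h) (duhamelDeriv β c₁ c₂ h x) x := by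
  have hr : ∀ (γ : ℂ) (c : E), LocallyIntegrable fun t => γ • expConv γ c h t + h t :=
    fun γ c => ((continuous_expConv γ c hh).const_smul γ).locallyIntegrable.add hh
  have hv := continuous_duhamelDeriv β c₁ c₂ hh
  have key : duhamel β c₁ c₂ h =
      fun x => (2 * β)⁻¹ • (c₁ - c₂) + ∫ t in (0 : ℝ)..x, duhamelDeriv β c₁ c₂ h t := by
    ext1 x
    rw [duhamel, expConv_eq_integral β c₁ hh, expConv_eq_integral (-β) c₂ hh, add_sub_add_comm,
      ← intervalIntegral.integral_sub ((hr _ _).intervalIntegrable_of_real _ _)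
        ((hr _ _).intervalIntegrable_of_real _ _), smul_add, ← intervalIntegral.integral_smul]
    congr 2
    ext1 t
    rw [add_sub_add_right_eq_sub, neg_smul, sub_neg_eq_add, ← smul_add, smul_smul, duhamelDeriv]
    congr 1
    field_simp
  rw [key]
  exact (intervalIntegral.integral_hasDerivAt_right (hv.intervalIntegrable _ _)
    (hv.stronglyMeasurableAtFilter _ _) hv.continuousAt).const_add _

theorem duhamelDeriv_eq_integral {β : ℂ} (hβ : β ≠ 0) (c₁ c₂ : E) {h : ℝ → E}
    (hh : LocallyIntegrable h) (x : ℝ) :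
    duhamelDeriv β c₁ c₂ h x = (2⁻¹ : ℂ) • (c₁ + c₂) +
      ∫ t in (0 : ℝ)..x, (β ^ 2 • duhamel β c₁ c₂ h t + h t) := by
  have hr : ∀ (γ : ℂ) (c : E), LocallyIntegrable fun t => γ • expConv γ c h t + h t :=
    fun γ c => ((continuous_expConv γ c hh).const_smul γ).locallyIntegrable.add hh
  rw [duhamelDeriv, expConv_eq_integral β c₁ hh, expConv_eq_integral (-β) c₂ hh, add_add_add_comm,
    ← intervalIntegral.integral_add ((hr _ _).intervalIntegrable_of_real _ _)
      ((hr _ _).intervalIntegrable_of_real _ _), smul_add, ← intervalIntegral.integral_smul]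
  congr 2
  ext1 t
  have e : β ^ 2 * (2 * β)⁻¹ = 2⁻¹ * β := by field_simp
  rw [duhamel, smul_smul, e]
  module

end Duhamel

/-! ### Riemann–Lebesgue lemma for `∫ e^{γy} f(y) dy` with `Re γ ≤ 0`. -/

section RiemannLebesgue

variable {E : Type*} [NormedAddCommGroup E] [NormedSpace ℂ E]

theorem norm_cexp_mul_le_one {γ : ℂ} (hγ : γ.re ≤ 0) {y : ℝ} (hy : 0 ≤ y) :
    ‖Complex.exp (γ * y)‖ ≤ 1 := by
  rw [Complex.norm_exp, Real.exp_le_one_iff, Complex.re_mul_ofReal]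
  exact mul_nonpos_of_nonpos_of_nonneg hγ hy

theorem integrable_cexp_mul_smul {f : ℝ → E} (hf : IntegrableOn f (Set.Ioi 0)) {γ : ℂ}
    (hγ : γ.re ≤ 0) : IntegrableOn (fun y : ℝ => Complex.exp (γ * y) • f y) (Set.Ioi 0) := by
  refine Integrable.mono hf
    ((continuous_cexp_mul γ).aestronglyMeasurable.smul hf.aestronglyMeasurable) ?_
  filter_upwards [ae_restrict_mem measurableSet_Ioi] with y hy
  rw [norm_smul]
  exact mul_le_of_le_one_left (norm_nonneg _) (norm_cexp_mul_le_one hγ (le_of_lt hy))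

theorem norm_integral_cexp_mul_smul_le {f : ℝ → E} (hf : IntegrableOn f (Set.Ioi 0)) {γ : ℂ}
    (hγ : γ.re ≤ 0) :
    ‖∫ y : ℝ in Set.Ioi 0, Complex.exp (γ * y) • f y‖ ≤ ∫ y in Set.Ioi 0, ‖f y‖ := by
  refine (norm_integral_le_integral_norm _).trans
    (setIntegral_mono_on (integrable_cexp_mul_smul hf hγ).norm hf.norm measurableSet_Ioi
      fun y hy => ?_)
  rw [norm_smul]
  exact mul_le_of_le_one_left (norm_nonneg _) (norm_cexp_mul_le_one hγ (le_of_lt hy))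

/-- One integration by parts gains `1/|γ|`, with a constant independent of `arg γ`. The boundary
term `g 0` stays because `g` need not vanish at the origin. -/
theorem norm_integral_cexp_mul_smul_le_div [CompleteSpace E] {g g' : ℝ → E}
    (hg : ∀ x, HasDerivAt g (g' x) x) (hg' : Continuous g') (hs : HasCompactSupport g)
    (hs' : HasCompactSupport g') {γ : ℂ} (hγ : γ.re ≤ 0) (hγ0 : γ ≠ 0) :
    ‖∫ y : ℝ in Set.Ioi 0, Complex.exp (γ * y) • g y‖ ≤
      ‖γ‖⁻¹ * (‖g 0‖ + ∫ y in Set.Ioi 0, ‖g' y‖) := by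
  have hgc : Continuous g := continuous_iff_continuousAt.2 fun x => (hg x).continuousAt
  have hgi : IntegrableOn g (Set.Ioi 0) := (hgc.integrable_of_hasCompactSupport hs).integrableOn
  have hgi' : IntegrableOn g' (Set.Ioi 0) := (hg'.integrable_of_hasCompactSupport hs').integrableOn
  have hd : ∀ x ∈ Set.Ici (0 : ℝ), HasDerivAt (fun y : ℝ => Complex.exp (γ * y) • g y)
      (Complex.exp (γ * x) • g' x + γ • Complex.exp (γ * x) • g x) x := fun x _ => by
    rw [← mul_smul]
    exact (hasDerivAt_cexp_mul γ x).smul (hg x)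
  have h1 := integrable_cexp_mul_smul hgi hγ
  have h2 := integrable_cexp_mul_smul hgi' hγ
  have ht : Tendsto (fun y : ℝ => Complex.exp (γ * y) • g y) atTop (𝓝 0) := by
    refine tendsto_const_nhds.congr' ?_
    filter_upwards [atTop_le_cocompact hs.compl_mem_cocompact] with x hx
    simp [image_eq_zero_of_notMem_tsupport hx]
  have := integral_Ioi_of_hasDerivAt_of_tendsto' hd (h2.add (h1.smul γ)) ht
  rw [integral_add (f := fun y : ℝ => Complex.exp (γ * y) • g' y) h2
    (g := fun y : ℝ => γ • Complex.exp (γ * y) • g y) (h1.smul γ), integral_smul] at this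
  have e : ∫ y : ℝ in Set.Ioi 0, Complex.exp (γ * y) • g y =
      γ⁻¹ • (-g 0 - ∫ y : ℝ in Set.Ioi 0, Complex.exp (γ * y) • g' y) := by
    rw [eq_inv_smul_iff₀ hγ0, eq_sub_iff_add_eq', this]
    simp
  rw [e, norm_smul, norm_inv]
  gcongr
  refine (norm_sub_le _ _).trans ?_
  rw [norm_neg]
  gcongr
  exact norm_integral_cexp_mul_smul_le hgi' hγ

/-- The Riemann–Lebesgue lemma, uniformly in the closed left half-plane. -/
theorem tendsto_integral_cexp_mul_smul [CompleteSpace E] {f : ℝ → E}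
    (hf : IntegrableOn f (Set.Ioi 0)) :
    Tendsto (fun γ : ℂ => ∫ y : ℝ in Set.Ioi 0, Complex.exp (γ * y) • f y)
      (Bornology.cobounded ℂ ⊓ 𝓟 {γ | γ.re ≤ 0}) (𝓝 0) := by
  rw [Metric.tendsto_nhds]
  intro ε hε
  -- Replacing `f` by a smooth compactly supported `g` costs at most the `L¹` distance, uniformly in
  -- `γ`, since `|e^{γy}| ≤ 1`.
  obtain ⟨g, hgs, hgc, hg⟩ := (memLp_one_iff_integrable.2 hf).exist_eLpNorm_sub_le
    (by simp) le_rfl (half_pos hε)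
  have hd : ∀ x, HasDerivAt g (deriv g x) x := fun x =>
    (hgc.differentiable (by simp)).differentiableAt.hasDerivAt
  have hgi : IntegrableOn g (Set.Ioi 0) :=
    (hgc.continuous.integrable_of_hasCompactSupport hgs).integrableOn
  have hfg : ∫ y in Set.Ioi 0, ‖(f - g) y‖ ≤ ε / 2 := by
    rw [eLpNorm_one_eq_lintegral_enorm] at hg
    rw [integral_norm_eq_lintegral_enorm (hf.sub hgi).aestronglyMeasurable]
    exact ENNReal.toReal_le_of_le_ofReal (half_pos hε).le hg
  have hlim : Tendsto (fun γ : ℂ => ‖γ‖⁻¹ * (‖g 0‖ + ∫ y in Set.Ioi 0, ‖deriv g y‖))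
      (Bornology.cobounded ℂ ⊓ 𝓟 {γ | γ.re ≤ 0}) (𝓝 0) := by
    have := (tendsto_inv_atTop_zero.comp (tendsto_norm_cobounded_atTop (E := ℂ))).mul_const
      (‖g 0‖ + ∫ y in Set.Ioi 0, ‖deriv g y‖)
    rw [zero_mul] at this
    exact this.mono_left inf_le_left
  filter_upwards [hlim.eventually_lt_const (half_pos hε), mem_inf_of_right (mem_principal_self _),
    mem_inf_of_left (Bornology.eventually_ne_cobounded (0 : ℂ))] with γ h1 h2 h3
  rw [dist_zero_right]
  have h4 := norm_integral_cexp_mul_smul_le_div hd (hgc.continuous_deriv (by simp)) hgs hgs.deriv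
    h2 h3
  have h5 := norm_integral_cexp_mul_smul_le (hf.sub hgi) h2
  have h6 : ∫ y : ℝ in Set.Ioi 0, Complex.exp (γ * y) • f y =
      (∫ y : ℝ in Set.Ioi 0, Complex.exp (γ * y) • (f - g) y) +
        ∫ y : ℝ in Set.Ioi 0, Complex.exp (γ * y) • g y := by
    rw [← integral_add (integrable_cexp_mul_smul (hf.sub hgi) h2)
      (integrable_cexp_mul_smul hgi h2)]
    simp [smul_sub]
  rw [h6]
  exact (norm_add_le _ _).trans_lt (by linarith)

end RiemannLebesgue

/-! ### Neumann series for integral equations depending on a parameter. -/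

section Neumann

variable {V : Type*} [NormedAddCommGroup V] [NormedSpace ℂ V]
  {P : Type*} [TopologicalSpace P] [FirstCountableTopology P] {μ : Measure ℝ}

/-- The terms of the Neumann series of the integral operator with kernel `K`. -/
def neumannTerm (μ : Measure ℝ) (K : P × ℝ → ℝ → V →L[ℂ] V) (f : P × ℝ → V) : ℕ → P × ℝ → V
  | 0 => f
  | n + 1 => fun z => ∫ y, K z y (neumannTerm μ K f n (z.1, y)) ∂μ

variable {K : P × ℝ → ℝ → V →L[ℂ] V} {b : ℝ → ℝ} {f : P × ℝ → V} {C : ℝ}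

/-- Each application of the operator halves the sup norm. The majorant `b` does not depend on the
parameter, so dominated convergence preserves joint continuity. -/
theorem neumannTerm_spec (hb : Integrable b μ) (hb2 : ∫ y, b y ∂μ ≤ 1 / 2)
    (hKc : ∀ y, Continuous fun z => K z y) (hKm : ∀ z, AEStronglyMeasurable (K z) μ)
    (hKb : ∀ z y, ‖K z y‖ ≤ b y) (hf : Continuous f) (hfC : ∀ z, ‖f z‖ ≤ C) (hC : 0 ≤ C) (n : ℕ) :
    Continuous (neumannTerm μ K f n) ∧ ∀ z, ‖neumannTerm μ K f n z‖ ≤ C * (1 / 2) ^ n := by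
  induction n with
  | zero => exact ⟨hf, by simpa [neumannTerm] using hfC⟩
  | succ n ih =>
    obtain ⟨hc, hbd⟩ := ih
    have hle : ∀ z y, ‖K z y (neumannTerm μ K f n (z.1, y))‖ ≤ b y * (C * (1 / 2) ^ n) :=
      fun z y => ((K z y).le_opNorm _).trans
        (mul_le_mul (hKb z y) (hbd _) (norm_nonneg _) ((norm_nonneg _).trans (hKb z y)))
    refine ⟨?_, fun z => ?_⟩
    · refine continuous_of_dominated (bound := fun y => b y * (C * (1 / 2) ^ n)) (fun z => ?_)
        (fun z => .of_forall (hle z)) (hb.mul_const _) (.of_forall fun y => ?_)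
      · exact (ContinuousLinearMap.id ℂ (V →L[ℂ] V)).aestronglyMeasurable_comp₂ (hKm z)
          (hc.comp (Continuous.prodMk_right z.1)).aestronglyMeasurable
      · exact (hKc y).clm_apply (hc.comp (by fun_prop))
    · refine (norm_integral_le_of_norm_le (hb.mul_const _) (.of_forall (hle z))).trans ?_
      rw [integral_mul_const, pow_succ]
      calc (∫ y, b y ∂μ) * (C * (1 / 2) ^ n) ≤ 1 / 2 * (C * (1 / 2) ^ n) := by gcongr
        _ = _ := by ring

/-- Joint continuity in the parameter is what later carries the Dirichlet-to-Neumann matrix to real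
`k`. The lemma serves twice: with `P` a quadrant for Jost solutions, and with `P = Unit` for
solutions of the initial value problem. -/
theorem exists_continuous_fixedPoint [CompleteSpace V] (hb : Integrable b μ)
    (hb2 : ∫ y, b y ∂μ ≤ 1 / 2)
    (hKc : ∀ y, Continuous fun z => K z y) (hKm : ∀ z, AEStronglyMeasurable (K z) μ)
    (hKb : ∀ z y, ‖K z y‖ ≤ b y) (hf : Continuous f) (hfC : ∀ z, ‖f z‖ ≤ C) (hC : 0 ≤ C) :
    ∃ F : P × ℝ → V, Continuous F ∧ (∀ z, ‖F z‖ ≤ 2 * C) ∧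
      ∀ z, F z = f z + ∫ y, K z y (F (z.1, y)) ∂μ := by
  have hs := neumannTerm_spec hb hb2 hKc hKm hKb hf hfC hC
  have hg : HasSum (fun n : ℕ => C * (1 / 2 : ℝ) ^ n) (2 * C) := by
    simpa [mul_comm] using hasSum_geometric_two.mul_left C
  have hsum : ∀ z, Summable fun n => neumannTerm μ K f n z := fun z =>
    .of_norm_bounded hg.summable fun n => (hs n).2 z
  refine ⟨fun z => ∑' n, neumannTerm μ K f n z,
    continuous_tsum (fun n => (hs n).1) hg.summable fun n z => (hs n).2 z,
    fun z => tsum_of_norm_bounded hg fun n => (hs n).2 z, fun z => ?_⟩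
  have hle : ∀ n y, ‖K z y (neumannTerm μ K f n (z.1, y))‖ ≤ b y * (C * (1 / 2) ^ n) :=
    fun n y => ((K z y).le_opNorm _).trans
      (mul_le_mul (hKb z y) ((hs n).2 _) (norm_nonneg _) ((norm_nonneg _).trans (hKb z y)))
  have := hasSum_integral_of_dominated_convergence
    (F := fun n y => K z y (neumannTerm μ K f n (z.1, y)))
    (f := fun y => K z y (∑' n, neumannTerm μ K f n (z.1, y)))
    (μ := μ) (fun n y => b y * (C * (1 / 2) ^ n))
    (fun n => (ContinuousLinearMap.id ℂ (V →L[ℂ] V)).aestronglyMeasurable_comp₂ (hKm z)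
      ((hs n).1.comp (Continuous.prodMk_right z.1)).aestronglyMeasurable)
    (fun n => .of_forall (hle n))
    (.of_forall fun y => hg.summable.mul_left _)
    (by simpa only [tsum_mul_left] using hb.mul_const _)
    (.of_forall fun y => (K z y).hasSum (hsum _).hasSum)
  beta_reduce
  rw [(hsum z).tsum_eq_zero_add, ← this.tsum_eq]
  rfl

end Neumann

/-! ### Diagonalising the free system by `P₊` and `P₋`. -/

section System

theorem absolutelyContinuousOnInterval_congr {E : Type*} [NormedAddCommGroup E] {f g : ℝ → E}
    {a b : ℝ} (hf : AbsolutelyContinuousOnInterval f a b) (h : ∀ x ∈ Set.uIcc a b, f x = g x) :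
    AbsolutelyContinuousOnInterval g a b := by
  refine Tendsto.congr' ?_ hf
  filter_upwards [mem_inf_of_right (mem_principal_self _)] with E hE
  refine Finset.sum_congr rfl fun i hi => ?_
  rw [h _ (hE.1 i hi).1, h _ (hE.1 i hi).2]

/-- The projections `P₊` (`true`) and `P₋` (`false`). -/
def proj (s : Bool) : (Fin 2 → ℂ) →L[ℂ] (Fin 2 → ℂ) :=
  (Matrix.mulVecLin (cond s Pplus Pminus)).toContinuousLinearMap

/-- The exponents `i k` (`true`) and `-k` (`false`). -/
def rate (k : ℂ) (s : Bool) : ℂ := cond s (Complex.I * k) (-k)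

/-- The diagonal matrix `ε Q(y)`. -/
def coef (q : ℝ → ℂ) (y : ℝ) : (Fin 2 → ℂ) →L[ℂ] (Fin 2 → ℂ) :=
  conj (q y) • (ContinuousLinearMap.single ℂ (fun _ : Fin 2 => ℂ) 0).comp
      (ContinuousLinearMap.proj 0) +
    q y • (ContinuousLinearMap.single ℂ (fun _ : Fin 2 => ℂ) 1).comp (ContinuousLinearMap.proj 1)

theorem proj_true_apply (v : Fin 2 → ℂ) : proj true v = ![(v 0 + v 1) / 2, (v 0 + v 1) / 2] := by
  ext i
  fin_cases i <;> simp [proj, Pplus, Matrix.mulVec, dotProduct] <;> ring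

theorem proj_false_apply (v : Fin 2 → ℂ) :
    proj false v = ![(v 0 - v 1) / 2, (v 1 - v 0) / 2] := by
  ext i
  fin_cases i <;> simp [proj, Pminus, Matrix.mulVec, dotProduct] <;> ring

theorem coef_apply (q : ℝ → ℂ) (y : ℝ) (v : Fin 2 → ℂ) :
    coef q y v = ![conj (q y) * v 0, q y * v 1] := by
  ext i
  fin_cases i <;> simp [coef]

theorem eps_mulVec (v : Fin 2 → ℂ) : eps *ᵥ v = ![v 1, v 0] := by
  ext i
  fin_cases i <;> simp [eps, Matrix.mulVec, dotProduct]

/-- Multiplying the equation by `ε` turns `Q` into the diagonal matrix `εQ`, which is the form used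
from here on. -/
theorem potential_mulVec (q : ℝ → ℂ) (y : ℝ) (v : Fin 2 → ℂ) :
    potential q y *ᵥ v = eps *ᵥ coef q y v := by
  rw [eps_mulVec, coef_apply]
  ext i
  fin_cases i <;> simp [potential, Matrix.mulVec, dotProduct]

theorem sum_proj (v : Fin 2 → ℂ) : ∑ s, proj s v = v := by
  rw [Fintype.sum_bool, proj_true_apply, proj_false_apply]
  ext i
  fin_cases i <;> simp <;> ring

/-- The range of each projection is an eigenspace of `ε`, with eigenvalue `1` or `-1`, so the
squared rates `-k²` and `k²` are the two values of `-k²ε`. -/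
theorem rate_sq_smul_proj (k : ℂ) (s : Bool) (v : Fin 2 → ℂ) :
    rate k s ^ 2 • proj s v = -(k ^ 2 • (eps *ᵥ proj s v)) := by
  rw [eps_mulVec]
  cases s
  · rw [proj_false_apply]
    ext i
    fin_cases i <;> simp [rate] <;> ring
  · rw [proj_true_apply]
    ext i
    fin_cases i <;> simp [rate, mul_pow]

theorem norm_proj_apply_le (s : Bool) (v : Fin 2 → ℂ) : ‖proj s v‖ ≤ ‖v‖ := by
  have h0 := norm_le_pi_norm v 0
  have h1 := norm_le_pi_norm v 1
  have h2 := norm_add_le (v 0) (v 1)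
  have h3 := norm_sub_le (v 0) (v 1)
  have h4 := norm_sub_le (v 1) (v 0)
  rw [pi_norm_le_iff_of_nonneg (norm_nonneg _)]
  cases s
  · rw [proj_false_apply, Fin.forall_fin_two]
    constructor <;> simp <;> linarith
  · rw [proj_true_apply, Fin.forall_fin_two]
    constructor <;> simp <;> linarith

theorem norm_coef_apply_le (q : ℝ → ℂ) (y : ℝ) (v : Fin 2 → ℂ) :
    ‖coef q y v‖ ≤ ‖q y‖ * ‖v‖ := by
  rw [pi_norm_le_iff_of_nonneg (by positivity), coef_apply, Fin.forall_fin_two]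
  constructor <;> simp <;> gcongr <;> exact norm_le_pi_norm v _

theorem rate_ne_zero {k : ℂ} (hk : k ≠ 0) (s : Bool) : rate k s ≠ 0 := by
  cases s <;> simp [rate, hk]

theorem norm_rate (k : ℂ) (s : Bool) : ‖rate k s‖ = ‖k‖ := by
  cases s <;> simp [rate]

theorem aestronglyMeasurable_coef {q : ℝ → ℂ} {μ : Measure ℝ} (hq : AEStronglyMeasurable q μ) :
    AEStronglyMeasurable (coef q) μ :=
  ((Complex.continuous_conj.comp_aestronglyMeasurable hq).smul_const _).add (hq.smul_const _)

/-- The solution of `-ε Y'' + ε h = k² Y` assembled from `duhamel` on the ranges of `P±`. -/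
def sysSol (k : ℂ) (c₁ c₂ : Bool → Fin 2 → ℂ) (h : ℝ → Fin 2 → ℂ) (x : ℝ) : Fin 2 → ℂ :=
  ∑ s, proj s (duhamel (rate k s) (c₁ s) (c₂ s) h x)

/-- The derivative of `sysSol`. -/
def sysDeriv (k : ℂ) (c₁ c₂ : Bool → Fin 2 → ℂ) (h : ℝ → Fin 2 → ℂ) (x : ℝ) : Fin 2 → ℂ :=
  ∑ s, proj s (duhamelDeriv (rate k s) (c₁ s) (c₂ s) h x)

variable {k : ℂ} {c₁ c₂ : Bool → Fin 2 → ℂ} {h : ℝ → Fin 2 → ℂ}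

theorem hasDerivAt_sysSol (hk : k ≠ 0) (hh : LocallyIntegrable h) (x : ℝ) :
    HasDerivAt (sysSol k c₁ c₂ h) (sysDeriv k c₁ c₂ h x) x :=
  HasDerivAt.fun_sum fun s _ => ((proj s).restrictScalars ℝ).hasFDerivAt.comp_hasDerivAt x
    (hasDerivAt_duhamel (rate_ne_zero hk s) (c₁ s) (c₂ s) hh x)

theorem continuous_sysDeriv (hh : LocallyIntegrable h) : Continuous (sysDeriv k c₁ c₂ h) :=
  continuous_finsetSum _ fun s _ =>
    (proj s).continuous.comp (continuous_duhamelDeriv (rate k s) (c₁ s) (c₂ s) hh)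

theorem continuous_sysSol (hh : LocallyIntegrable h) : Continuous (sysSol k c₁ c₂ h) :=
  continuous_finsetSum _ fun s _ =>
    (proj s).continuous.comp (continuous_duhamel (rate k s) (c₁ s) (c₂ s) hh)

theorem locallyIntegrable_sysSol_add (hh : LocallyIntegrable h) :
    LocallyIntegrable fun t => -(k ^ 2 • (eps *ᵥ sysSol k c₁ c₂ h t)) + h t := by
  refine LocallyIntegrable.add (Continuous.locallyIntegrable ?_) hh
  have : Continuous fun t => eps *ᵥ sysSol k c₁ c₂ h t :=
    continuous_const.matrix_mulVec (continuous_sysSol hh)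
  exact (this.const_smul (k ^ 2)).neg

theorem sysDeriv_eq_integral (hk : k ≠ 0) (hh : LocallyIntegrable h) (x : ℝ) :
    sysDeriv k c₁ c₂ h x = sysDeriv k c₁ c₂ h 0 +
      ∫ t in (0 : ℝ)..x, (-(k ^ 2 • (eps *ᵥ sysSol k c₁ c₂ h t)) + h t) := by
  have hi : ∀ s : Bool, IntervalIntegrable
      (fun t => rate k s ^ 2 • duhamel (rate k s) (c₁ s) (c₂ s) h t + h t) volume 0 x := fun s =>
    LocallyIntegrable.intervalIntegrable_of_real
      (LocallyIntegrable.add ((continuous_duhamel (rate k s) (c₁ s) (c₂ s) hh).const_smul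
        (rate k s ^ 2)).locallyIntegrable hh) 0 x
  have e : ∀ t, -(k ^ 2 • (eps *ᵥ sysSol k c₁ c₂ h t)) + h t =
      ∑ s, proj s (rate k s ^ 2 • duhamel (rate k s) (c₁ s) (c₂ s) h t + h t) := fun t => by
    simp_rw [map_add, map_smul, Finset.sum_add_distrib, sum_proj, rate_sq_smul_proj,
      Finset.sum_neg_distrib, ← Finset.smul_sum]
    rw [sysSol, ← Matrix.mulVecLin_apply, map_sum]
    rfl
  simp_rw [e]
  rw [intervalIntegral.integral_finsetSum
    (fun s _ => by
      exact ⟨(proj s).integrable_comp (hi s).1, (proj s).integrable_comp (hi s).2⟩)]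
  simp_rw [(proj _).intervalIntegral_comp_comm (hi _)]
  simp only [sysDeriv]
  rw [← Finset.sum_add_distrib]
  refine Finset.sum_congr rfl fun s _ => ?_
  rw [← map_add, duhamelDeriv_eq_integral (rate_ne_zero hk s) _ _ hh x,
    duhamelDeriv_eq_integral (rate_ne_zero hk s) _ _ hh 0]
  simp

theorem dHalf_sysSol (hk : k ≠ 0) (hh : LocallyIntegrable h) {x : ℝ} (hx : 0 ≤ x) :
    dHalf (sysSol k c₁ c₂ h) x = sysDeriv k c₁ c₂ h x :=
  (hasDerivAt_sysSol hk hh x).hasDerivWithinAt.derivWithin (uniqueDiffOn_Ici 0 x hx)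

/-- Any fixed point of variation of constants, with the potential term as inhomogeneity, solves the
equation. Both the Jost and the initial value constructions end here. -/
theorem isSolution_sysSol {q : ℝ → ℂ} (hk : k ≠ 0) (hh : LocallyIntegrable h)
    (heq : ∀ᵐ x ∂(volume.restrict (Set.Ioi (0 : ℝ))), h x = coef q x (sysSol k c₁ c₂ h x)) :
    IsSolution q (k ^ 2) (sysSol k c₁ c₂ h) where
  differentiable x _ := (hasDerivAt_sysSol hk hh x).differentiableAt.differentiableWithinAt
  absCont b _ := by
    refine absolutelyContinuousOnInterval_congr
      ((absolutelyContinuousOnInterval_const (sysSol k c₁ c₂ h 0) 0 b).fun_add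
        ((continuous_sysDeriv (c₁ := c₁) (c₂ := c₂) (k := k)
          hh).locallyIntegrable.absolutelyContinuousOnInterval_integral 0 b 0)) fun x _ => ?_
    rw [intervalIntegral.integral_eq_sub_of_hasDerivAt (fun t _ => hasDerivAt_sysSol hk hh t)
      ((continuous_sysDeriv hh).intervalIntegrable _ _)]
    abel
  absCont_deriv b hb := by
    refine absolutelyContinuousOnInterval_congr
      ((absolutelyContinuousOnInterval_const (sysDeriv k c₁ c₂ h 0) 0 b).fun_add
        ((locallyIntegrable_sysSol_add (k := k) (c₁ := c₁) (c₂ := c₂)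
          hh).absolutelyContinuousOnInterval_integral 0 b 0)) fun x hx => ?_
    rw [Set.uIcc_of_le hb.le] at hx
    rw [dHalf_sysSol hk hh hx.1, sysDeriv_eq_integral hk hh x]
  equation := by
    have := ae_restrict_of_ae (s := Set.Ioi (0 : ℝ)) (LocallyIntegrable.ae_hasDerivAt_integral
      (locallyIntegrable_sysSol_add (k := k) (c₁ := c₁) (c₂ := c₂) hh))
    filter_upwards [this, heq, ae_restrict_mem measurableSet_Ioi] with x h1 h2 hx
    refine ⟨_, ((h1 0).const_add (sysDeriv k c₁ c₂ h 0)).congr_of_eventuallyEq ?_, ?_⟩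
    · filter_upwards [Ioi_mem_nhds hx] with t ht
      rw [dHalf_sysSol hk hh (le_of_lt ht), sysDeriv_eq_integral hk hh t]
    · rw [potential_mulVec, ← h2]
      simp only [eps_mulVec]
      ext i
      fin_cases i <;> simp

end System

/-! ### Bounded and decaying solutions of the scalar equation. -/

section JostScalar

variable {E : Type*} [NormedAddCommGroup E] [NormedSpace ℂ E]

theorem integrable_smul_of_continuous_of_le {μ : Measure ℝ} {f : ℝ → E} (hf : Integrable f μ)
    {g : ℝ → ℂ} (hg : Continuous g) {C : ℝ} (hC : ∀ y, ‖g y‖ ≤ C) :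
    Integrable (fun y => g y • f y) μ := by
  refine Integrable.mono' (hf.norm.const_mul C) (hg.aestronglyMeasurable.smul hf.1)
    (.of_forall fun y => ?_)
  rw [norm_smul]
  gcongr
  exact hC y

/-- The Green kernel of `u'' = β² u` on the half-line with a Dirichlet condition at `0`. -/
def jostKer (β : ℂ) (x y : ℝ) : ℂ :=
  (2 * β)⁻¹ * (Complex.exp (β * (|x - y| : ℝ)) - Complex.exp (β * (|x| + |y| : ℝ)))

theorem continuous_jostKer (β : ℂ) : Continuous fun z : ℝ × ℝ => jostKer β z.1 z.2 := by
  unfold jostKer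
  fun_prop

theorem norm_jostKer_le_exp {β : ℂ} (hβ : β.re ≤ 0) (x y : ℝ) :
    ‖jostKer β x y‖ ≤ ‖β‖⁻¹ * Real.exp (β.re * |x - y|) := by
  have h : Real.exp (β.re * (|x| + |y|)) ≤ Real.exp (β.re * |x - y|) :=
    Real.exp_le_exp.2 (mul_le_mul_of_nonpos_left (abs_sub x y) hβ)
  have := norm_sub_le (Complex.exp (β * (|x - y| : ℝ))) (Complex.exp (β * (|x| + |y| : ℝ)))
  rw [Complex.norm_exp, Complex.norm_exp, Complex.re_mul_ofReal, Complex.re_mul_ofReal] at this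
  rw [jostKer, norm_mul, norm_inv, norm_mul, Complex.norm_ofNat, mul_inv]
  calc 2⁻¹ * ‖β‖⁻¹ * _ ≤ 2⁻¹ * ‖β‖⁻¹ * (2 * Real.exp (β.re * |x - y|)) := by
        gcongr
        linarith
    _ = _ := by ring

theorem norm_jostKer_le {β : ℂ} (hβ : β.re ≤ 0) (x y : ℝ) : ‖jostKer β x y‖ ≤ ‖β‖⁻¹ := by
  refine (norm_jostKer_le_exp hβ x y).trans (mul_le_of_le_one_right (by positivity) ?_)
  rw [Real.exp_le_one_iff]
  exact mul_nonpos_of_nonpos_of_nonneg hβ (abs_nonneg _)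

variable {β : ℂ} {c : E} {h : ℝ → E} {x : ℝ}

theorem cexp_smul_intervalIntegral (β : ℂ) (h : ℝ → E) (x : ℝ) :
    Complex.exp (β * x) • ∫ y in (0 : ℝ)..x, Complex.exp (-β * y) • h y =
      ∫ y in (0 : ℝ)..x, Complex.exp (β * (x - y : ℝ)) • h y := by
  rw [← intervalIntegral.integral_smul]
  congr 1
  ext1 y
  rw [smul_smul, ← Complex.exp_add]
  congr 2
  push_cast
  ring

theorem norm_intervalIntegral_cexp_le (hβ : β.re ≤ 0) (hh : Integrable h) (hx : 0 ≤ x) :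
    ‖∫ y in (0 : ℝ)..x, Complex.exp (β * (x - y : ℝ)) • h y‖ ≤ ∫ y, ‖h y‖ := by
  calc _ ≤ ∫ y in (0 : ℝ)..x, ‖h y‖ := by
        refine intervalIntegral.norm_integral_le_of_norm_le hx (.of_forall fun y hy => ?_)
          hh.norm.intervalIntegrable
        rw [norm_smul]
        exact mul_le_of_le_one_left (norm_nonneg _)
          (norm_cexp_mul_le_one hβ (sub_nonneg.2 hy.2))
    _ ≤ _ := by
        rw [intervalIntegral.integral_of_le hx]
        exact setIntegral_le_integral hh.norm (.of_forall fun _ => norm_nonneg _)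

theorem norm_expConv_le (hβ : β.re ≤ 0) (hh : Integrable h) (hx : 0 ≤ x) :
    ‖expConv β c h x‖ ≤ ‖c‖ + ∫ y, ‖h y‖ := by
  rw [expConv, smul_add, cexp_smul_intervalIntegral]
  refine (norm_add_le _ _).trans (add_le_add ?_ (norm_intervalIntegral_cexp_le hβ hh hx))
  rw [norm_smul]
  exact mul_le_of_le_one_left (norm_nonneg _) (norm_cexp_mul_le_one hβ hx)

/-- This initial value removes the growing exponential `e^{-βx}`: what is left is a tail integral
over `(x, ∞)` with a bounded kernel. -/
theorem expConv_neg_eq (hβ : β.re ≤ 0) (hh : Integrable h) (hx : 0 ≤ x) :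
    expConv (-β) (-∫ y : ℝ in Set.Ioi 0, Complex.exp (β * y) • h y) h x =
      -∫ y in Set.Ioi x, Complex.exp (β * (y - x : ℝ)) • h y := by
  have hi := integrable_cexp_mul_smul (γ := β) hh.integrableOn hβ
  have e : ∫ y : ℝ in Set.Ioi 0, Complex.exp (β * y) • h y =
      (∫ y in (0 : ℝ)..x, Complex.exp (β * y) • h y) +
        ∫ y : ℝ in Set.Ioi x, Complex.exp (β * y) • h y := by
    rw [intervalIntegral.integral_of_le hx, ← setIntegral_union (Set.Ioc_disjoint_Ioi le_rfl)
      measurableSet_Ioi (hi.mono_set Set.Ioc_subset_Ioi_self)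
      (hi.mono_set (Set.Ioi_subset_Ioi hx)), Set.Ioc_union_Ioi_eq_Ioi hx]
  rw [expConv, neg_neg, e, neg_add_rev, neg_add_cancel_right, smul_neg, ← integral_smul]
  congr 2
  ext1 y
  rw [smul_smul, ← Complex.exp_add]
  congr 2
  push_cast
  ring

theorem norm_integral_Ioi_cexp_le (hβ : β.re ≤ 0) (hh : Integrable h) (x : ℝ) :
    ‖∫ y in Set.Ioi x, Complex.exp (β * (y - x : ℝ)) • h y‖ ≤ ∫ y, ‖h y‖ := by
  calc _ ≤ ∫ y in Set.Ioi x, ‖h y‖ := by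
        refine norm_integral_le_of_norm_le hh.norm.integrableOn ?_
        filter_upwards [ae_restrict_mem measurableSet_Ioi] with y hy
        rw [norm_smul]
        exact mul_le_of_le_one_left (norm_nonneg _)
          (norm_cexp_mul_le_one hβ (sub_nonneg.2 (le_of_lt hy)))
    _ ≤ _ := setIntegral_le_integral hh.norm (.of_forall fun _ => norm_nonneg _)

/-- The decaying solution of `u'' = β² u + h` with `u(0) = c`. -/
def jostDuhamel (β : ℂ) (c : E) (h : ℝ → E) : ℝ → E :=
  duhamel β ((2 * β) • c - ∫ y : ℝ in Set.Ioi 0, Complex.exp (β * y) • h y)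
    (-∫ y : ℝ in Set.Ioi 0, Complex.exp (β * y) • h y) h

/-- In `jostDuhamel` the value `c₂` suppresses growth, and `c₁ = 2βc + c₂` enforces `u(0) = c`.
Splitting `|x - y|` at `y = x` identifies the outcome with the Green kernel. -/
theorem jostDuhamel_eq (hβ : β.re ≤ 0) (hβ0 : β ≠ 0) (hh : Integrable h) (hx : 0 ≤ x) :
    jostDuhamel β c h x =
      Complex.exp (β * x) • c + ∫ y in Set.Ioi 0, jostKer β x y • h y := by
  have hi := integrable_cexp_mul_smul (γ := β) hh.integrableOn hβ
  have hi2 : Integrable fun y => Complex.exp (β * (|x - y| : ℝ)) • h y :=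
    integrable_smul_of_continuous_of_le (C := 1) hh (by fun_prop)
      fun y => norm_cexp_mul_le_one hβ (abs_nonneg _)
  have e1 : ∫ y : ℝ in Set.Ioi 0, Complex.exp (β * (|x - y| : ℝ)) • h y =
      (∫ y in (0 : ℝ)..x, Complex.exp (β * (x - y : ℝ)) • h y) +
        ∫ y : ℝ in Set.Ioi x, Complex.exp (β * (y - x : ℝ)) • h y := by
    rw [← Set.Ioc_union_Ioi_eq_Ioi hx, setIntegral_union (Set.Ioc_disjoint_Ioi le_rfl)
      measurableSet_Ioi hi2.integrableOn hi2.integrableOn, intervalIntegral.integral_of_le hx]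
    congr 1
    · refine setIntegral_congr_fun measurableSet_Ioc fun y hy => ?_
      simp only [abs_of_nonneg (sub_nonneg.2 hy.2)]
    · refine setIntegral_congr_fun measurableSet_Ioi fun y hy => ?_
      simp only [abs_sub_comm x y, abs_of_pos (sub_pos.2 (Set.mem_Ioi.1 hy))]
  have e2 : ∫ y in Set.Ioi 0, jostKer β x y • h y =
      (2 * β)⁻¹ • ((∫ y : ℝ in Set.Ioi 0, Complex.exp (β * (|x - y| : ℝ)) • h y) -
        Complex.exp (β * x) • ∫ y : ℝ in Set.Ioi 0, Complex.exp (β * y) • h y) := by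
    rw [← integral_smul (Complex.exp (β * x)), ← integral_sub hi2.integrableOn
      (g := fun y : ℝ => Complex.exp (β * x) • Complex.exp (β * y) • h y)
      (hi.smul (Complex.exp (β * x))), ← integral_smul]
    refine setIntegral_congr_fun measurableSet_Ioi fun y hy => ?_
    simp only [jostKer, abs_of_nonneg hx, abs_of_pos (Set.mem_Ioi.1 hy), mul_smul, sub_smul,
      Complex.ofReal_add, mul_add, Complex.exp_add]
  have e3 : (2 * β)⁻¹ • (2 * β) • Complex.exp (β * x) • c = Complex.exp (β * x) • c :=
    inv_smul_smul₀ (by simpa using hβ0) _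
  rw [jostDuhamel, duhamel, expConv_neg_eq hβ hh hx, e2, e1, expConv, smul_add,
    cexp_smul_intervalIntegral, smul_sub (Complex.exp (β * x)), smul_comm (Complex.exp (β * x)),
    sub_neg_eq_add, add_assoc, sub_add, smul_sub, e3, sub_eq_add_neg, ← smul_neg]
  congr 2
  abel

/-- The Wronskian argument needs the derivative bounded as well as the solution. -/
theorem exists_norm_duhamel_le (hβ : β.re ≤ 0) (hh : Integrable h) : ∃ C, ∀ x : ℝ, 0 ≤ x →
    ‖jostDuhamel β c h x‖ ≤ C ∧
    ‖duhamelDeriv β ((2 * β) • c - ∫ y : ℝ in Set.Ioi 0, Complex.exp (β * y) • h y)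
      (-∫ y : ℝ in Set.Ioi 0, Complex.exp (β * y) • h y) h x‖ ≤ C := by
  set b := ∫ y : ℝ in Set.Ioi 0, Complex.exp (β * y) • h y with hb
  set H := ∫ y, ‖h y‖
  set S := ‖(2 * β) • c - b‖ + H + H
  refine ⟨max (‖(2 * β)⁻¹‖ * S) (‖(2⁻¹ : ℂ)‖ * S), fun x hx => ?_⟩
  have h1 := norm_expConv_le (c := (2 * β) • c - b) hβ hh hx
  have h2 : ‖expConv (-β) (-b) h x‖ ≤ H := by
    rw [hb, expConv_neg_eq hβ hh hx, norm_neg]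
    exact norm_integral_Ioi_cexp_le hβ hh x
  constructor
  · refine le_trans ?_ (le_max_left _ _)
    rw [jostDuhamel, duhamel, norm_smul]
    gcongr
    exact (norm_sub_le _ _).trans (by linarith)
  · refine le_trans ?_ (le_max_right _ _)
    rw [duhamelDeriv, norm_smul]
    gcongr
    exact (norm_add_le _ _).trans (by linarith)

/-- For `Re β < 0` the kernel is dominated by a multiple of `e^{Re β |x - y|}`, so the integral term
is controlled by a convolution of two `L¹` functions. -/
theorem integrableOn_jostDuhamel (hβ : β.re < 0) (hh : Integrable h)
    (hh0 : ∀ y ∉ Set.Ioi (0 : ℝ), h y = 0) :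
    IntegrableOn (jostDuhamel β c h) (Set.Ioi 0) := by
  have hβ0 : β ≠ 0 := by
    rintro rfl
    simp at hβ
  have hexp : Integrable fun x : ℝ => Real.exp (β.re * |x|) := by
    have h1 : IntegrableOn (fun x : ℝ => Real.exp (β.re * |x|)) (Set.Ioi 0) :=
      (integrableOn_exp_mul_Ioi hβ 0).congr_fun
        (fun x hx => by simp only [abs_of_pos (Set.mem_Ioi.1 hx)]) measurableSet_Ioi
    have h2 : IntegrableOn (fun x : ℝ => Real.exp (β.re * |x|)) (Set.Iic 0) :=
      (integrableOn_exp_mul_Iic (neg_pos.2 hβ) 0).congr_fun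
        (fun x hx => by simp only [abs_of_nonpos (Set.mem_Iic.1 hx), neg_mul, mul_neg])
        measurableSet_Iic
    simpa using h2.union h1
  have hconv := (hh.norm.convolution_integrand (ContinuousLinearMap.mul ℝ ℝ) hexp).const_mul ‖β‖⁻¹
  have hprod : Integrable (fun z : ℝ × ℝ => jostKer β z.1 z.2 • h z.2) (volume.prod volume) := by
    refine hconv.mono' ((continuous_jostKer β).aestronglyMeasurable.smul hh.1.comp_snd)
      (.of_forall fun z => ?_)
    rw [norm_smul]
    calc _ ≤ ‖β‖⁻¹ * Real.exp (β.re * |z.1 - z.2|) * ‖h z.2‖ := by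
          gcongr
          exact norm_jostKer_le_exp hβ.le _ _
      _ = _ := by
          simp only [ContinuousLinearMap.mul_apply']
          ring
  have h1 : IntegrableOn (fun x : ℝ => Complex.exp (β * x) • c) (Set.Ioi 0) :=
    (integrableOn_exp_mul_complex_Ioi hβ 0).smul_const c
  refine (h1.add hprod.integral_prod_left.integrableOn).congr_fun (fun x hx => ?_)
    measurableSet_Ioi
  rw [jostDuhamel_eq hβ.le hβ0 hh (le_of_lt hx)]
  simp only [Pi.add_apply]
  congr 1
  refine (setIntegral_eq_integral_of_forall_compl_eq_zero fun y hy => ?_).symm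
  rw [hh0 y hy, smul_zero]

end JostScalar

/-! ### Jost solutions of the system on the closed quadrant. -/

section Jost

/-- The part `|k| ≥ R` of the closed first quadrant. -/
def quadrant (R : ℝ) : Set ℂ := {k | 0 ≤ k.re ∧ 0 ≤ k.im ∧ R ≤ ‖k‖}

/-- A radius beyond which the integral equations are contractive. -/
def radius (q : ℝ → ℂ) : ℝ := 4 * (∫ y in Set.Ioi 0, ‖q y‖) + 1

theorem radius_pos (q : ℝ → ℂ) : 0 < radius q := by
  have : 0 ≤ ∫ y in Set.Ioi 0, ‖q y‖ := integral_nonneg fun _ => norm_nonneg _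
  unfold radius
  linarith

variable {q : ℝ → ℂ}

theorem ne_zero_of_radius_le {k : ℂ} (hk : radius q ≤ ‖k‖) : k ≠ 0 :=
  norm_pos_iff.1 ((radius_pos q).trans_le hk)

theorem rate_re_nonpos {k : ℂ} (h1 : 0 ≤ k.re) (h2 : 0 ≤ k.im) (s : Bool) :
    (rate k s).re ≤ 0 := by
  cases s <;> simpa [rate]

theorem rate_re_neg {k : ℂ} (h1 : 0 < k.re) (h2 : 0 < k.im) (s : Bool) :
    (rate k s).re < 0 := by
  cases s <;> simpa [rate]

theorem continuous_rate (s : Bool) : Continuous fun k => rate k s := by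
  cases s <;> simp only [rate, cond_true, cond_false] <;> fun_prop

/-- The majorant of the kernels of the integral equations. -/
def majorant (q : ℝ → ℂ) (y : ℝ) : ℝ := 2 * (radius q)⁻¹ * ‖q y‖

theorem integrable_majorant (hq : IntegrableOn q (Set.Ioi 0)) :
    Integrable (majorant q) (volume.restrict (Set.Ioi 0)) :=
  hq.norm.const_mul _

/-- The `2` in the majorant counts the two projections, each of norm at most one. With the radius
`4‖q‖₁ + 1` the integral is `2‖q‖₁ / (4‖q‖₁ + 1)`; the added `1` keeps the radius positive when
`‖q‖₁ = 0`. -/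
theorem integral_majorant_le (q : ℝ → ℂ) : ∫ y in Set.Ioi 0, majorant q y ≤ 1 / 2 := by
  have h := radius_pos q
  simp only [majorant]
  rw [integral_const_mul, mul_assoc, mul_comm, mul_assoc, inv_mul_le_iff₀ h]
  unfold radius
  linarith

/-- The kernel `∑ g_s (P_s ε Q(y))` with scalar coefficients `g`. -/
def sysKer (q : ℝ → ℂ) (g : Bool → ℂ) (y : ℝ) : (Fin 2 → ℂ) →L[ℂ] (Fin 2 → ℂ) :=
  ∑ s, g s • (proj s).comp (coef q y)

theorem sysKer_apply (q : ℝ → ℂ) (g : Bool → ℂ) (y : ℝ) (v : Fin 2 → ℂ) :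
    sysKer q g y v = ∑ s, g s • proj s (coef q y v) := by
  simp [sysKer]

theorem norm_sysKer_le {g : Bool → ℂ} {C : ℝ} (hg : ∀ s, ‖g s‖ ≤ C) (y : ℝ) :
    ‖sysKer q g y‖ ≤ 2 * C * ‖q y‖ := by
  have hC : 0 ≤ C := (norm_nonneg _).trans (hg true)
  refine ContinuousLinearMap.opNorm_le_bound _ (by positivity) fun v => ?_
  have key : ∀ s, ‖g s • proj s (coef q y v)‖ ≤ C * (‖q y‖ * ‖v‖) := fun s => by
    rw [norm_smul]
    gcongr
    · exact hg s
    · exact (norm_proj_apply_le s _).trans (norm_coef_apply_le q y v)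
  rw [sysKer_apply, Fintype.sum_bool]
  refine (norm_add_le _ _).trans ((add_le_add (key _) (key _)).trans (le_of_eq ?_))
  ring

theorem norm_sysKer_le_majorant {g : Bool → ℂ} {k : ℂ} (hk : radius q ≤ ‖k‖)
    (hg : ∀ s, ‖g s‖ ≤ ‖k‖⁻¹) (y : ℝ) : ‖sysKer q g y‖ ≤ majorant q y :=
  norm_sysKer_le (fun s => (hg s).trans (inv_anti₀ (radius_pos q) hk)) y

theorem aestronglyMeasurable_sysKer {μ : Measure ℝ} (hq : AEStronglyMeasurable q μ)
    {g : ℝ → Bool → ℂ} (hg : ∀ s, Continuous fun y => g y s) :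
    AEStronglyMeasurable (fun y => sysKer q (g y) y) μ := by
  simp only [sysKer, Fintype.sum_bool]
  have h := fun s => (hg s).aestronglyMeasurable (μ := μ) |>.smul
    ((proj s).postcomp (Fin 2 → ℂ) |>.continuous.comp_aestronglyMeasurable
      (aestronglyMeasurable_coef hq))
  exact (h true).add (h false)

theorem continuous_sysKer {X : Type*} [TopologicalSpace X] {g : X → Bool → ℂ}
    (hg : ∀ s, Continuous fun z => g z s) (y : ℝ) : Continuous fun z => sysKer q (g z) y :=
  continuous_finsetSum _ fun s _ => (hg s).smul continuous_const

/-- The solution `e^{kTx} c` of the free equation, extended evenly. -/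
def freeSol (k : ℂ) (c : Fin 2 → ℂ) (x : ℝ) : Fin 2 → ℂ :=
  ∑ s, Complex.exp (rate k s * (|x| : ℝ)) • proj s c

theorem norm_freeSol_le {k : ℂ} (h1 : 0 ≤ k.re) (h2 : 0 ≤ k.im) (c : Fin 2 → ℂ) (x : ℝ) :
    ‖freeSol k c x‖ ≤ 2 * ‖c‖ := by
  have key : ∀ s, ‖Complex.exp (rate k s * (|x| : ℝ)) • proj s c‖ ≤ ‖c‖ := fun s => by
    rw [norm_smul]
    exact (mul_le_of_le_one_left (norm_nonneg _)
      (norm_cexp_mul_le_one (rate_re_nonpos h1 h2 s) (abs_nonneg x))).trans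
      (norm_proj_apply_le s c)
  rw [freeSol, Fintype.sum_bool, two_mul]
  exact (norm_add_le _ _).trans (add_le_add (key _) (key _))

/-- A family of bounded solutions of the Jost integral equation with `F(0) = c`. -/
structure IsJost (q : ℝ → ℂ) (c : Fin 2 → ℂ) (F : quadrant (radius q) × ℝ → Fin 2 → ℂ) :
    Prop where
  cont : Continuous F
  bound : ∀ z, ‖F z‖ ≤ 4 * ‖c‖
  eq : ∀ z, F z = freeSol z.1 c z.2 +
    ∫ y in Set.Ioi 0, sysKer q (fun s => jostKer (rate z.1 s) z.2 y) y (F (z.1, y))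

theorem exists_isJost (hq : IntegrableOn q (Set.Ioi 0)) (c : Fin 2 → ℂ) : ∃ F, IsJost q c F := by
  have hk : ∀ (k : quadrant (radius q)) (s : Bool) (x y : ℝ),
      ‖jostKer (rate k s) x y‖ ≤ ‖(k : ℂ)‖⁻¹ := fun k s x y => by
    rw [← norm_rate k s]
    exact norm_jostKer_le (rate_re_nonpos k.2.1 k.2.2.1 s) x y
  obtain ⟨F, h1, h2, h3⟩ := exists_continuous_fixedPoint (P := quadrant (radius q))
    (μ := volume.restrict (Set.Ioi 0)) (b := majorant q) (C := 2 * ‖c‖)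
    (K := fun z y => sysKer q (fun s => jostKer (rate z.1 s) z.2 y) y)
    (f := fun z => freeSol z.1 c z.2)
    (integrable_majorant hq) (integral_majorant_le q)
    (fun y => continuous_sysKer (fun s => by
      have hr : Continuous fun z : quadrant (radius q) × ℝ => rate z.1 s :=
        (continuous_rate s).comp (by fun_prop)
      have h0 : ∀ z : quadrant (radius q) × ℝ, 2 * rate z.1 s ≠ 0 := fun z =>
        mul_ne_zero two_ne_zero (rate_ne_zero (ne_zero_of_radius_le z.1.2.2.2) s)
      simp only [jostKer]
      exact ((continuous_const.mul hr).inv₀ h0).mul (by fun_prop)) y)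
    (fun z => aestronglyMeasurable_sysKer hq.1 fun s =>
      (continuous_jostKer _).comp (Continuous.prodMk_right z.2))
    (fun z y => norm_sysKer_le_majorant z.1.2.2.2 (fun s => hk z.1 s z.2 y) y)
    (by
      unfold freeSol
      have hr : ∀ s, Continuous fun z : quadrant (radius q) × ℝ => rate z.1 s := fun s =>
        (continuous_rate s).comp (by fun_prop)
      fun_prop)
    (fun z => norm_freeSol_le z.1.2.1 z.1.2.2.1 c z.2) (by positivity)
  exact ⟨F, h1, fun z => (h2 z).trans (by linarith), h3⟩

variable {c : Fin 2 → ℂ} {F : quadrant (radius q) × ℝ → Fin 2 → ℂ}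

/-- The inhomogeneity `ε Q F`, cut off to the half-line. -/
def source (q : ℝ → ℂ) (f : ℝ → Fin 2 → ℂ) : ℝ → Fin 2 → ℂ :=
  (Set.Ioi 0).indicator fun y => coef q y (f y)

theorem integrableOn_coef_apply (hq : IntegrableOn q (Set.Ioi 0)) {f : ℝ → Fin 2 → ℂ}
    (hf : Continuous f) {C : ℝ} (hC : ∀ x, ‖f x‖ ≤ C) :
    IntegrableOn (fun y => coef q y (f y)) (Set.Ioi 0) := by
  refine (hq.norm.mul_const C).mono' ?_ (.of_forall fun y => ?_)
  · exact (ContinuousLinearMap.id ℂ ((Fin 2 → ℂ) →L[ℂ] (Fin 2 → ℂ))).aestronglyMeasurable_comp₂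
      (aestronglyMeasurable_coef hq.1) hf.aestronglyMeasurable
  · exact (norm_coef_apply_le q y _).trans (by gcongr; exact hC y)

theorem IsJost.integrableOn (hF : IsJost q c F) (hq : IntegrableOn q (Set.Ioi 0))
    (k : quadrant (radius q)) : IntegrableOn (fun y => coef q y (F (k, y))) (Set.Ioi 0) :=
  integrableOn_coef_apply hq (hF.cont.comp (Continuous.prodMk_right k)) fun _ => hF.bound _

theorem IsJost.integrable_source (hF : IsJost q c F) (hq : IntegrableOn q (Set.Ioi 0))
    (k : quadrant (radius q)) : Integrable (source q fun y => F (k, y)) :=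
  (integrable_indicator_iff measurableSet_Ioi).2 (hF.integrableOn hq k)

/-- The Jost solution. -/
def jostSol (q : ℝ → ℂ) (c : Fin 2 → ℂ) (F : quadrant (radius q) × ℝ → Fin 2 → ℂ)
    (k : quadrant (radius q)) : ℝ → Fin 2 → ℂ :=
  sysSol k
    (fun s => (2 * rate k s) • c -
      ∫ y : ℝ in Set.Ioi 0, Complex.exp (rate k s * y) • source q (fun y => F (k, y)) y)
    (fun s => -∫ y : ℝ in Set.Ioi 0, Complex.exp (rate k s * y) • source q (fun y => F (k, y)) y)
    (source q fun y => F (k, y))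

theorem jostSol_eq_sum (k : quadrant (radius q)) (x : ℝ) : jostSol q c F k x =
    ∑ s, proj s (jostDuhamel (rate k s) c (source q fun y => F (k, y)) x) := rfl

theorem source_of_pos (f : ℝ → Fin 2 → ℂ) {y : ℝ} (hy : y ∈ Set.Ioi (0 : ℝ)) :
    source q f y = coef q y (f y) := Set.indicator_of_mem hy _

/-- The fixed point `F` carries boundedness and continuity in `k`, the Duhamel form `jostSol`
carries regularity in `x`; this lemma links the two on the half-line. -/
theorem IsJost.jostSol_eq (hF : IsJost q c F) (hq : IntegrableOn q (Set.Ioi 0))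
    (k : quadrant (radius q)) {x : ℝ} (hx : 0 ≤ x) : jostSol q c F k x = F (k, x) := by
  have hk := ne_zero_of_radius_le k.2.2.2
  have hi : ∀ s, IntegrableOn (fun y => jostKer (rate k s) x y • coef q y (F (k, y)))
      (Set.Ioi 0) := fun s => integrable_smul_of_continuous_of_le (hF.integrableOn hq k)
    ((continuous_jostKer _).comp (Continuous.prodMk_right x))
    (norm_jostKer_le (rate_re_nonpos k.2.1 k.2.2.1 s) x)
  have e : ∀ s, ∫ y in Set.Ioi 0, jostKer (rate k s) x y • source q (fun y => F (k, y)) y =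
      ∫ y in Set.Ioi 0, jostKer (rate k s) x y • coef q y (F (k, y)) := fun s =>
    setIntegral_congr_fun measurableSet_Ioi fun y hy => by
      simp only [source_of_pos (q := q) (fun y => F (k, y)) hy]
  rw [jostSol_eq_sum, hF.eq, freeSol]
  simp_rw [jostDuhamel_eq (rate_re_nonpos k.2.1 k.2.2.1 _) (rate_ne_zero hk _)
    (hF.integrable_source hq k) hx, e, map_add, map_smul, Finset.sum_add_distrib, sysKer_apply,
    abs_of_nonneg hx]
  congr 1
  rw [integral_finsetSum _ fun s _ => by
    simpa only [map_smul] using (proj s).integrable_comp (hi s)]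
  refine Finset.sum_congr rfl fun s _ => ?_
  rw [← (proj s).integral_comp_comm (hi s)]
  simp only [map_smul]

theorem IsJost.isSolution (hF : IsJost q c F) (hq : IntegrableOn q (Set.Ioi 0))
    (k : quadrant (radius q)) : IsSolution q ((k : ℂ) ^ 2) (jostSol q c F k) := by
  refine isSolution_sysSol (ne_zero_of_radius_le k.2.2.2)
    (hF.integrable_source hq k).locallyIntegrable ?_
  filter_upwards [ae_restrict_mem measurableSet_Ioi] with x hx
  rw [source_of_pos _ hx]
  congr 1
  exact (hF.jostSol_eq hq k (le_of_lt hx)).symm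

theorem IsJost.jostSol_zero (k : quadrant (radius q)) : jostSol q c F k 0 = c := by
  have hk := ne_zero_of_radius_le k.2.2.2
  have : ∀ s, jostDuhamel (rate k s) c (source q fun y => F (k, y)) 0 = c := fun s => by
    have h2 : 2 * rate k s ≠ 0 := mul_ne_zero two_ne_zero (rate_ne_zero hk s)
    rw [jostDuhamel, duhamel, expConv_zero, expConv_zero, sub_neg_eq_add, sub_add_cancel,
      inv_smul_smul₀ h2]
  rw [jostSol_eq_sum]
  simp_rw [this, sum_proj]

/-- The correction `J` in `Y'(0) = k T c - J`. -/
def jostCorr (q : ℝ → ℂ) (F : quadrant (radius q) × ℝ → Fin 2 → ℂ) (k : quadrant (radius q)) :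
    Fin 2 → ℂ :=
  ∑ s, proj s (∫ y : ℝ in Set.Ioi 0, Complex.exp (rate k s * y) • coef q y (F (k, y)))

theorem sum_rate_smul_proj (k : ℂ) (c : Fin 2 → ℂ) :
    ∑ s, rate k s • proj s c = (k • T) *ᵥ c := by
  rw [Fintype.sum_bool, proj_true_apply, proj_false_apply]
  ext i
  fin_cases i <;> simp [rate, T, Pplus, Pminus, Matrix.mulVec, dotProduct] <;> ring

theorem IsJost.dHalf_jostSol_zero (hF : IsJost q c F) (hq : IntegrableOn q (Set.Ioi 0))
    (k : quadrant (radius q)) :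
    dHalf (jostSol q c F k) 0 = ((k : ℂ) • T) *ᵥ c - jostCorr q F k := by
  rw [jostSol, dHalf_sysSol (ne_zero_of_radius_le k.2.2.2)
    (hF.integrable_source hq k).locallyIntegrable le_rfl, ← sum_rate_smul_proj, jostCorr,
    ← Finset.sum_sub_distrib]
  refine Finset.sum_congr rfl fun s _ => ?_
  have e : ∫ y : ℝ in Set.Ioi 0, Complex.exp (rate k s * y) • source q (fun y => F (k, y)) y =
      ∫ y : ℝ in Set.Ioi 0, Complex.exp (rate k s * y) • coef q y (F (k, y)) :=
    setIntegral_congr_fun measurableSet_Ioi fun y hy => by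
      simp only [source_of_pos (q := q) (fun y => F (k, y)) hy]
  rw [duhamelDeriv, expConv_zero, expConv_zero]
  beta_reduce
  rw [e, ← map_smul, ← map_sub]
  congr 1
  module

theorem IsJost.exists_bound (hF : IsJost q c F) (hq : IntegrableOn q (Set.Ioi 0))
    (k : quadrant (radius q)) :
    ∃ C, ∀ x : ℝ, 0 ≤ x → ‖jostSol q c F k x‖ ≤ C ∧ ‖dHalf (jostSol q c F k) x‖ ≤ C := by
  choose C hC using fun s => exists_norm_duhamel_le (c := c)
    (rate_re_nonpos k.2.1 k.2.2.1 s) (hF.integrable_source hq k)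
  refine ⟨∑ s, C s, fun x hx => ⟨?_, ?_⟩⟩
  · rw [jostSol_eq_sum]
    exact (norm_sum_le _ _).trans (Finset.sum_le_sum fun s _ =>
      (norm_proj_apply_le s _).trans (hC s x hx).1)
  · rw [jostSol, dHalf_sysSol (ne_zero_of_radius_le k.2.2.2)
      (hF.integrable_source hq k).locallyIntegrable hx]
    exact (norm_sum_le _ _).trans (Finset.sum_le_sum fun s _ =>
      (norm_proj_apply_le s _).trans (hC s x hx).2)

theorem memLp_two_of_integrable_of_bound {μ : Measure ℝ} {f : ℝ → Fin 2 → ℂ} (hf : Integrable f μ)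
    {C : ℝ} (hC : ∀ᵐ x ∂μ, ‖f x‖ ≤ C) : MemLp f 2 μ := by
  rw [memLp_two_iff_integrable_sq_norm hf.1]
  refine (hf.norm.const_mul C).mono' (hf.1.norm.pow 2) ?_
  filter_upwards [hC] with x hx
  rw [Real.norm_of_nonneg (by positivity), sq]
  gcongr

/-- Integrable and bounded implies square integrable. Strict positivity of both parts of `k` makes
both rates decay; on the boundary of the quadrant one of them only oscillates. -/
theorem IsJost.memLp (hF : IsJost q c F) (hq : IntegrableOn q (Set.Ioi 0))
    (k : quadrant (radius q)) (h1 : 0 < (k : ℂ).re) (h2 : 0 < (k : ℂ).im) :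
    MemLp (jostSol q c F k) 2 (volume.restrict (Set.Ioi 0)) := by
  obtain ⟨C, hC⟩ := hF.exists_bound hq k
  refine memLp_two_of_integrable_of_bound (C := C) ?_ ?_
  · change Integrable (fun x => ∑ s, proj s (jostDuhamel (rate k s) c _ x)) _
    refine integrable_finsetSum _ fun s _ => (proj s).integrable_comp ?_
    exact integrableOn_jostDuhamel (rate_re_neg h1 h2 s) (hF.integrable_source hq k)
      fun y hy => Set.indicator_of_notMem hy _
  · filter_upwards [ae_restrict_mem measurableSet_Ioi] with x hx
    exact (hC x (le_of_lt hx)).1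

theorem IsJost.continuous_jostCorr (hF : IsJost q c F) (hq : IntegrableOn q (Set.Ioi 0)) :
    Continuous (jostCorr q F) := by
  refine continuous_finsetSum _ fun s _ => (proj s).continuous.comp ?_
  refine continuous_of_dominated (bound := fun y => ‖q y‖ * (4 * ‖c‖)) (fun k => ?_)
    (fun k => ?_) (hq.norm.mul_const _) (.of_forall fun y => ?_)
  · exact (continuous_cexp_mul _).aestronglyMeasurable.smul (hF.integrableOn hq k).1
  · filter_upwards [ae_restrict_mem measurableSet_Ioi] with y hy
    rw [norm_smul]
    refine (mul_le_of_le_one_left (norm_nonneg _) (norm_cexp_mul_le_one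
      (rate_re_nonpos k.2.1 k.2.2.1 s) (le_of_lt hy))).trans ?_
    exact (norm_coef_apply_le q y _).trans (by gcongr; exact hF.bound _)
  · have hr : Continuous fun k : quadrant (radius q) => rate k s :=
      (continuous_rate s).comp continuous_subtype_val
    exact (Complex.continuous_exp.comp (hr.mul continuous_const)).smul
      ((coef q y).continuous.comp (hF.cont.comp (Continuous.prodMk_left y)))

/-- Large `|k|` in the quadrant. -/
def quadrantAtInfinity (q : ℝ → ℂ) : Filter (quadrant (radius q)) :=
  comap (↑) (Bornology.cobounded ℂ)

theorem IsJost.norm_sub_freeSol_le (hF : IsJost q c F) (hq : IntegrableOn q (Set.Ioi 0))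
    (k : quadrant (radius q)) (x : ℝ) :
    ‖F (k, x) - freeSol k c x‖ ≤ ‖(k : ℂ)‖⁻¹ * (8 * ‖c‖ * ∫ y in Set.Ioi 0, ‖q y‖) := by
  rw [hF.eq, add_sub_cancel_left, ← integral_const_mul, ← integral_const_mul]
  refine norm_integral_le_of_norm_le ((hq.norm.const_mul _).const_mul _) (.of_forall fun y => ?_)
  refine (ContinuousLinearMap.le_opNorm _ _).trans ?_
  have h1 : ‖sysKer q (fun s => jostKer (rate k s) x y) y‖ ≤ 2 * ‖(k : ℂ)‖⁻¹ * ‖q y‖ :=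
    norm_sysKer_le (fun s => by
      rw [← norm_rate k s]
      exact norm_jostKer_le (rate_re_nonpos k.2.1 k.2.2.1 s) x y) y
  calc _ ≤ 2 * ‖(k : ℂ)‖⁻¹ * ‖q y‖ * (4 * ‖c‖) := by
        gcongr
        exact hF.bound _
    _ = _ := by ring

/-- The sums are `2ik`, `-2k` and `(i - 1)k`. No cancellation occurs, so every frequency fed to the
Riemann–Lebesgue lemma tends to infinity with `k`. -/
theorem norm_le_norm_rate_add (k : ℂ) (s t : Bool) : ‖k‖ ≤ ‖rate k s + rate k t‖ := by
  have h : ∀ w : ℂ, 1 ≤ ‖w‖ → ‖k‖ ≤ ‖w * k‖ := fun w hw => by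
    rw [norm_mul]
    exact le_mul_of_one_le_left (norm_nonneg _) hw
  cases s <;> cases t <;> simp only [rate, cond_true, cond_false]
  · convert h (-2) (by simp) using 2
    ring
  · convert h (-1 + Complex.I) ?_ using 2
    · ring
    · simpa using Complex.abs_im_le_norm (-1 + Complex.I)
  · convert h (-1 + Complex.I) ?_ using 2
    · ring
    · simpa using Complex.abs_im_le_norm (-1 + Complex.I)
  · convert h (2 * Complex.I) (by simp) using 2
    ring

theorem tendsto_rate_add (s t : Bool) :
    Tendsto (fun k : quadrant (radius q) => rate k s + rate k t) (quadrantAtInfinity q)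
      (Bornology.cobounded ℂ ⊓ 𝓟 {γ | γ.re ≤ 0}) := by
  refine tendsto_inf.2 ⟨?_, tendsto_principal.2 (.of_forall fun k => ?_)⟩
  · rw [← tendsto_norm_atTop_iff_cobounded]
    exact tendsto_atTop_mono (fun k => norm_le_norm_rate_add k s t)
      (tendsto_norm_cobounded_atTop.comp tendsto_comap)
  · exact add_nonpos (rate_re_nonpos k.2.1 k.2.2.1 s) (rate_re_nonpos k.2.1 k.2.2.1 t)

theorem IsJost.tendsto_jostCorr (hF : IsJost q c F) (hq : IntegrableOn q (Set.Ioi 0)) :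
    Tendsto (jostCorr q F) (quadrantAtInfinity q) (𝓝 0) := by
  rw [show (0 : Fin 2 → ℂ) = ∑ s : Bool, proj s 0 by simp]
  refine tendsto_finsetSum _ fun s _ => ((proj s).continuous.tendsto 0).comp ?_
  -- Splitting off the free solution leaves integrands `e^{γy}` times a fixed `L¹` function with `γ`
  -- a sum of two rates, to which Riemann–Lebesgue applies. The remainder is `O(1/|k|)` because the
  -- Jost solution is that close to the free one.
  have hsplit : ∀ k : quadrant (radius q),
      ∫ y : ℝ in Set.Ioi 0, Complex.exp (rate k s * y) • coef q y (F (k, y)) =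
      (∑ t, ∫ y : ℝ in Set.Ioi 0,
          Complex.exp ((rate k s + rate k t) * y) • coef q y (proj t c)) +
        ∫ y : ℝ in Set.Ioi 0,
          Complex.exp (rate k s * y) • coef q y (F (k, y) - freeSol k c y) := fun k => by
    have hr := rate_re_nonpos k.2.1 k.2.2.1
    have hc : ∀ t, IntegrableOn (fun y : ℝ =>
        Complex.exp ((rate k s + rate k t) * y) • coef q y (proj t c)) (Set.Ioi 0) := fun t =>
      integrable_cexp_mul_smul (integrableOn_coef_apply hq continuous_const fun _ => le_rfl)
        (add_nonpos (hr s) (hr t))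
    have hfree : Continuous (freeSol k c) := by
      unfold freeSol
      fun_prop
    have hd : IntegrableOn (fun y : ℝ =>
        Complex.exp (rate k s * y) • coef q y (F (k, y) - freeSol k c y)) (Set.Ioi 0) :=
      integrable_cexp_mul_smul (integrableOn_coef_apply hq
        ((hF.cont.comp (Continuous.prodMk_right k)).sub hfree)
        fun y => hF.norm_sub_freeSol_le hq k y) (hr s)
    rw [← integral_finsetSum _ fun t _ => hc t,
      ← integral_add (integrable_finsetSum _ fun t _ => hc t) hd]
    refine setIntegral_congr_fun measurableSet_Ioi fun y hy => ?_
    simp only [map_sub, smul_sub, freeSol, map_sum, map_smul, Finset.smul_sum, smul_smul,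
      abs_of_pos (Set.mem_Ioi.1 hy), add_mul, Complex.exp_add, add_sub_cancel]
  simp_rw [hsplit]
  rw [show (0 : Fin 2 → ℂ) = (∑ _t : Bool, 0) + 0 by simp]
  refine (tendsto_finsetSum _ fun t _ => ?_).add ?_
  · exact (tendsto_integral_cexp_mul_smul
      (integrableOn_coef_apply hq continuous_const fun _ => le_rfl)).comp (tendsto_rate_add s t)
  · have hlim : Tendsto (fun k : quadrant (radius q) => ‖(k : ℂ)‖⁻¹ *
        ((8 * ‖c‖ * ∫ y in Set.Ioi 0, ‖q y‖) * ∫ y in Set.Ioi 0, ‖q y‖))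
        (quadrantAtInfinity q) (𝓝 0) := by
      have := ((tendsto_inv_atTop_zero.comp (tendsto_norm_cobounded_atTop (E := ℂ))).mul_const
        ((8 * ‖c‖ * ∫ y in Set.Ioi 0, ‖q y‖) * ∫ y in Set.Ioi 0, ‖q y‖)).comp
        (tendsto_comap (f := ((↑) : quadrant (radius q) → ℂ)))
      rwa [zero_mul] at this
    refine squeeze_zero_norm (fun k => ?_) hlim
    rw [← mul_assoc, ← integral_const_mul]
    refine norm_integral_le_of_norm_le (hq.norm.const_mul _) ?_
    filter_upwards [ae_restrict_mem measurableSet_Ioi] with y hy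
    rw [norm_smul]
    refine (mul_le_of_le_one_left (norm_nonneg _) (norm_cexp_mul_le_one
      (rate_re_nonpos k.2.1 k.2.2.1 s) (le_of_lt hy))).trans ?_
    refine (norm_coef_apply_le q y _).trans ?_
    rw [mul_comm]
    gcongr
    exact hF.norm_sub_freeSol_le hq k y

end Jost

/-! ### Solutions with arbitrary Cauchy data at `0`. -/

section Regular

variable {E : Type*} [NormedAddCommGroup E] [NormedSpace ℂ E]

/-- The weighted Volterra kernel of `u'' = β² u`. -/
def volterraKer (β : ℂ) (κ : ℝ) (x y : ℝ) : ℂ :=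
  (2 * β)⁻¹ * (Complex.exp ((β - κ) * (max (x - y) 0 : ℝ)) -
    Complex.exp ((-β - κ) * (max (x - y) 0 : ℝ)))

theorem continuous_volterraKer (β : ℂ) (κ : ℝ) :
    Continuous fun z : ℝ × ℝ => volterraKer β κ z.1 z.2 := by
  unfold volterraKer
  fun_prop

theorem re_sub_norm_nonpos (β : ℂ) : (β - ‖β‖).re ≤ 0 := by
  simpa using Complex.re_le_norm β

theorem re_neg_sub_norm_nonpos (β : ℂ) : (-β - ‖β‖).re ≤ 0 := by
  simpa using re_sub_norm_nonpos (-β)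

/-- The weight `κ = ‖β‖` beats both `e^{βx}` and `e^{-βx}`, so the Volterra kernel obeys the same
`1/|β|` bound as the Green kernel, and the same contraction radius works. -/
theorem norm_volterraKer_le (β : ℂ) (x y : ℝ) : ‖volterraKer β ‖β‖ x y‖ ≤ ‖β‖⁻¹ := by
  have h0 : 0 ≤ max (x - y) 0 := le_max_right _ _
  have h1 := norm_cexp_mul_le_one (re_sub_norm_nonpos β) h0
  have h2 := norm_cexp_mul_le_one (re_neg_sub_norm_nonpos β) h0
  rw [volterraKer, norm_mul, norm_inv, norm_mul, Complex.norm_ofNat, mul_inv]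
  calc _ ≤ 2⁻¹ * ‖β‖⁻¹ * 2 := by
        gcongr
        exact (norm_sub_le _ _).trans (by linarith)
    _ = _ := by ring

theorem volterraKer_of_le {β : ℂ} {κ x y : ℝ} (h : x ≤ y) : volterraKer β κ x y = 0 := by
  simp [volterraKer, max_eq_right (sub_nonpos.2 h)]

theorem duhamel_eq_add_volterra (β : ℂ) (κ : ℝ) (c₁ c₂ : E) {w : ℝ → E} (hw : Integrable w)
    {x : ℝ} (hx : 0 ≤ x) :
    duhamel β c₁ c₂ (fun y => Complex.exp (κ * (|y| : ℝ)) • w y) x =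
      duhamel β c₁ c₂ 0 x +
        Complex.exp (κ * x) • ∫ y in Set.Ioi 0, volterraKer β κ x y • w y := by
  have hloc : LocallyIntegrable fun y : ℝ => Complex.exp (κ * (|y| : ℝ)) • w y :=
    hw.locallyIntegrable.continuous_smul (by fun_prop)
  have hi : ∀ γ : ℂ, IntervalIntegrable (fun y : ℝ => Complex.exp (γ * (x - y : ℝ)) •
      Complex.exp (κ * (|y| : ℝ)) • w y) volume 0 x := fun γ =>
    (hloc.continuous_smul (by fun_prop)).intervalIntegrable_of_real 0 x
  have e : Complex.exp (κ * x) • ∫ y in Set.Ioi 0, volterraKer β κ x y • w y =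
      (2 * β)⁻¹ • ((∫ y in (0 : ℝ)..x, Complex.exp (β * (x - y : ℝ)) •
        Complex.exp (κ * (|y| : ℝ)) • w y) - ∫ y in (0 : ℝ)..x, Complex.exp (-β * (x - y : ℝ)) •
        Complex.exp (κ * (|y| : ℝ)) • w y) := by
    rw [← intervalIntegral.integral_sub (hi _) (hi _), ← intervalIntegral.integral_smul,
      ← integral_smul, intervalIntegral.integral_of_le hx,
      setIntegral_eq_of_subset_of_forall_sdiff_eq_zero measurableSet_Ioi
        (Set.Ioc_subset_Ioi_self : Set.Ioc 0 x ⊆ Set.Ioi 0) fun y hy => ?_]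
    · refine setIntegral_congr_fun measurableSet_Ioc fun y hy => ?_
      have h1 : ∀ γ : ℂ, Complex.exp (κ * x) * Complex.exp ((γ - κ) * (x - y : ℝ)) =
          Complex.exp (γ * (x - y : ℝ)) * Complex.exp (κ * y) := fun γ => by
        rw [← Complex.exp_add, ← Complex.exp_add]
        congr 1
        push_cast
        ring
      simp only [volterraKer, max_eq_left (sub_nonneg.2 hy.2), abs_of_pos hy.1, smul_smul,
        ← sub_smul]
      congr 1
      rw [mul_left_comm, mul_sub, mul_sub, h1, h1]
      ring
    · have : x ≤ y := not_lt.1 fun h => hy.2 ⟨hy.1, h.le⟩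
      simp [volterraKer_of_le this]
  rw [e]
  simp only [duhamel, expConv, smul_add, Pi.zero_apply, smul_zero, intervalIntegral.integral_zero,
    add_zero]
  rw [cexp_smul_intervalIntegral, cexp_smul_intervalIntegral, ← smul_add]
  congr 1
  abel

theorem norm_cexp_neg_smul_duhamel_zero_le (β : ℂ) (c₁ c₂ : E) {x : ℝ} (hx : 0 ≤ x) :
    ‖Complex.exp (-(‖β‖ * x : ℝ)) • duhamel β c₁ c₂ 0 x‖ ≤ ‖(2 * β)⁻¹‖ * (‖c₁‖ + ‖c₂‖) := by
  have e : Complex.exp (-(‖β‖ * x : ℝ)) • duhamel β c₁ c₂ 0 x = (2 * β)⁻¹ •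
      (Complex.exp ((β - ‖β‖) * x) • c₁ - Complex.exp ((-β - ‖β‖) * x) • c₂) := by
    have h1 : ∀ γ : ℂ, Complex.exp (-(‖β‖ * x : ℝ)) * Complex.exp (γ * x) =
        Complex.exp ((γ - ‖β‖) * x) := fun γ => by
      rw [← Complex.exp_add]
      congr 1
      push_cast
      ring
    simp only [duhamel, expConv, Pi.zero_apply, smul_zero, intervalIntegral.integral_zero,
      add_zero]
    rw [smul_comm, smul_sub, smul_smul, smul_smul, h1, h1]
  rw [e, norm_smul]
  gcongr
  refine (norm_sub_le _ _).trans (add_le_add ?_ ?_) <;> rw [norm_smul]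
  · exact mul_le_of_le_one_left (norm_nonneg _) (norm_cexp_mul_le_one (re_sub_norm_nonpos β) hx)
  · exact mul_le_of_le_one_left (norm_nonneg _)
      (norm_cexp_mul_le_one (re_neg_sub_norm_nonpos β) hx)

theorem exists_isSolution_of_radius_le {q : ℝ → ℂ} (hq : IntegrableOn q (Set.Ioi 0)) {k : ℂ}
    (hk : radius q ≤ ‖k‖) (a b : Fin 2 → ℂ) :
    ∃ Y, IsSolution q (k ^ 2) Y ∧ Y 0 = a ∧ dHalf Y 0 = b := by
  have hk0 := ne_zero_of_radius_le hk
  -- The initial values of `u' + βu` and `u' - βu` for `u(0) = a`, `u'(0) = b`, where `β` is the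
  -- rate.
  set c₁ : Bool → Fin 2 → ℂ := fun s => rate k s • a + b with hc₁
  set c₂ : Bool → Fin 2 → ℂ := fun s => b - rate k s • a with hc₂
  set κ : ℝ := ‖k‖ with hκ
  set f : Unit × ℝ → Fin 2 → ℂ := fun z => Complex.exp (-(κ * |z.2| : ℝ)) •
    sysSol k c₁ c₂ 0 |z.2| with hf
  have hfc : Continuous f := by
    have h0 : Continuous (sysSol k c₁ c₂ 0) := continuous_sysSol locallyIntegrable_zero
    fun_prop
  have hfb : ∀ z, ‖f z‖ ≤ ∑ s, ‖(2 * rate k s)⁻¹‖ * (‖c₁ s‖ + ‖c₂ s‖) := fun z => by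
    simp only [hf, sysSol, Finset.smul_sum, ← map_smul]
    refine (norm_sum_le _ _).trans (Finset.sum_le_sum fun s _ =>
      (norm_proj_apply_le s _).trans ?_)
    rw [hκ, ← norm_rate k s]
    exact norm_cexp_neg_smul_duhamel_zero_le _ _ _ (abs_nonneg _)
  -- The unknown is `W = e^{-κx}Y`, which is bounded although `Y` may grow exponentially.
  obtain ⟨W, hWc, hWb, hW⟩ := exists_continuous_fixedPoint (P := Unit)
    (μ := volume.restrict (Set.Ioi 0)) (b := majorant q)
    (K := fun z y => sysKer q (fun s => volterraKer (rate k s) κ z.2 y) y)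
    (integrable_majorant hq) (integral_majorant_le q)
    (fun y => continuous_sysKer (fun s => (continuous_volterraKer _ _).comp
      (continuous_snd.prodMk continuous_const)) y)
    (fun z => aestronglyMeasurable_sysKer hq.1 fun s =>
      (continuous_volterraKer _ _).comp (Continuous.prodMk_right z.2))
    (fun z y => norm_sysKer_le_majorant hk (fun s => by
      rw [hκ, ← norm_rate k s]
      exact norm_volterraKer_le _ _ _) y)
    hfc hfb (Finset.sum_nonneg fun s _ => by positivity)
  set w : ℝ → Fin 2 → ℂ := source q fun y => W ((), y) with hw
  have hWc' : Continuous fun y => W ((), y) := hWc.comp (Continuous.prodMk_right ())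
  have hqW : IntegrableOn (fun y => coef q y (W ((), y))) (Set.Ioi 0) :=
    integrableOn_coef_apply hq hWc' fun _ => hWb _
  have hwi : Integrable w := (integrable_indicator_iff measurableSet_Ioi).2 hqW
  set h : ℝ → Fin 2 → ℂ := fun y => Complex.exp (κ * (|y| : ℝ)) • w y with hh
  have hhl : LocallyIntegrable h := hwi.locallyIntegrable.continuous_smul (by fun_prop)
  have hi : ∀ (s : Bool) (x : ℝ), IntegrableOn
      (fun y => volterraKer (rate k s) κ x y • coef q y (W ((), y))) (Set.Ioi 0) := fun s x =>
    integrable_smul_of_continuous_of_le hqW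
      ((continuous_volterraKer _ _).comp (Continuous.prodMk_right x)) (C := ‖rate k s‖⁻¹)
      (fun y => by
        rw [hκ, ← norm_rate k s]
        exact norm_volterraKer_le _ _ _)
  have key : ∀ x : ℝ, 0 ≤ x → sysSol k c₁ c₂ h x = Complex.exp (κ * x) • W ((), x) :=
      fun x hx => by
    have e : ∀ s, ∫ y in Set.Ioi 0, volterraKer (rate k s) κ x y • w y =
        ∫ y in Set.Ioi 0, volterraKer (rate k s) κ x y • coef q y (W ((), y)) := fun s =>
      setIntegral_congr_fun measurableSet_Ioi fun y hy => by
        simp only [hw, source_of_pos (q := q) (fun y => W ((), y)) hy]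
    rw [hW]
    simp only [hf, abs_of_nonneg hx, smul_add, smul_smul, ← Complex.exp_add, sysKer_apply]
    rw [integral_finsetSum _ fun s _ => by
      simpa only [map_smul] using (proj s).integrable_comp (hi s x)]
    simp only [sysSol, hh, duhamel_eq_add_volterra _ _ _ _ hwi hx, map_add,
      Finset.sum_add_distrib, e]
    congr 1
    · simp
    · rw [Finset.smul_sum]
      refine Finset.sum_congr rfl fun s _ => ?_
      rw [map_smul, ← (proj s).integral_comp_comm (hi s x)]
      simp only [map_smul]
  refine ⟨sysSol k c₁ c₂ h, isSolution_sysSol hk0 hhl ?_, ?_, ?_⟩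
  · filter_upwards [ae_restrict_mem measurableSet_Ioi] with x hx
    rw [key x (le_of_lt hx), map_smul]
    simp only [hh, hw, abs_of_pos (Set.mem_Ioi.1 hx), source_of_pos (q := q) _ hx]
  · have : ∀ s, duhamel (rate k s) (c₁ s) (c₂ s) h 0 = a := fun s => by
      have h2 : 2 * rate k s ≠ 0 := mul_ne_zero two_ne_zero (rate_ne_zero hk0 s)
      rw [duhamel, expConv_zero, expConv_zero, inv_smul_eq_iff₀ h2]
      simp only [hc₁, hc₂]
      module
    simp_rw [sysSol, this, sum_proj]
  · have : ∀ s, duhamelDeriv (rate k s) (c₁ s) (c₂ s) h 0 = b := fun s => by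
      rw [duhamelDeriv, expConv_zero, expConv_zero]
      simp only [hc₁, hc₂]
      module
    rw [dHalf_sysSol hk0 hhl le_rfl, sysDeriv]
    simp_rw [this, sum_proj]

end Regular

/-! ### Bilinear Wronskian of two solutions. -/

section Wronskian

variable {q : ℝ → ℂ} {lam : ℂ} {F G : ℝ → Fin 2 → ℂ}

theorem IsSolution.hasDerivWithinAt (hF : IsSolution q lam F) {x : ℝ} (hx : 0 ≤ x) :
    HasDerivWithinAt F (dHalf F x) (Set.Ici 0) x :=
  (hF.differentiable x hx).hasDerivWithinAt

theorem IsSolution.hasDerivAt (hF : IsSolution q lam F) {x : ℝ} (hx : 0 < x) :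
    HasDerivAt F (dHalf F x) x :=
  (hF.hasDerivWithinAt hx.le).hasDerivAt (Ici_mem_nhds hx)

theorem IsSolution.dHalf_add (hF : IsSolution q lam F) (hG : IsSolution q lam G) {x : ℝ}
    (hx : 0 ≤ x) : dHalf (fun x => F x + G x) x = dHalf F x + dHalf G x :=
  ((hF.hasDerivWithinAt hx).add (hG.hasDerivWithinAt hx)).derivWithin (uniqueDiffOn_Ici 0 x hx)

theorem IsSolution.dHalf_smul (hF : IsSolution q lam F) (c : ℂ) {x : ℝ} (hx : 0 ≤ x) :
    dHalf (fun x => c • F x) x = c • dHalf F x :=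
  ((hF.hasDerivWithinAt hx).const_smul c).derivWithin (uniqueDiffOn_Ici 0 x hx)

theorem IsSolution.add (hF : IsSolution q lam F) (hG : IsSolution q lam G) :
    IsSolution q lam fun x => F x + G x where
  differentiable := hF.differentiable.fun_add hG.differentiable
  absCont b hb := (hF.absCont b hb).fun_add (hG.absCont b hb)
  absCont_deriv b hb := by
    refine absolutelyContinuousOnInterval_congr
      ((hF.absCont_deriv b hb).fun_add (hG.absCont_deriv b hb)) fun x hx => ?_
    rw [Set.uIcc_of_le hb.le] at hx
    exact (hF.dHalf_add hG hx.1).symm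
  equation := by
    filter_upwards [hF.equation, hG.equation, ae_restrict_mem measurableSet_Ioi]
      with x ⟨F₂, hF1, hF2⟩ ⟨G₂, hG1, hG2⟩ hx
    refine ⟨F₂ + G₂, (hF1.add hG1).congr_of_eventuallyEq ?_, ?_⟩
    · filter_upwards [Ioi_mem_nhds hx] with t ht
      exact hF.dHalf_add hG (le_of_lt ht)
    · rw [mulVec_add, mulVec_add, smul_add, ← hF2, ← hG2]
      abel

theorem IsSolution.smul (hF : IsSolution q lam F) (c : ℂ) :
    IsSolution q lam fun x => c • F x where
  differentiable := hF.differentiable.fun_const_smul c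
  absCont b hb := (hF.absCont b hb).const_smul c
  absCont_deriv b hb := by
    refine absolutelyContinuousOnInterval_congr
      ((hF.absCont_deriv b hb).const_smul c) fun x hx => ?_
    rw [Set.uIcc_of_le hb.le] at hx
    exact (hF.dHalf_smul c hx.1).symm
  equation := by
    filter_upwards [hF.equation, ae_restrict_mem measurableSet_Ioi] with x ⟨F₂, hF1, hF2⟩ hx
    refine ⟨c • F₂, (hF1.const_smul c).congr_of_eventuallyEq ?_, ?_⟩
    · filter_upwards [Ioi_mem_nhds hx] with t ht
      exact hF.dHalf_smul c (le_of_lt ht)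
    · rw [mulVec_smul, mulVec_smul, smul_comm, ← hF2, smul_add, smul_neg]

theorem IsSolution.linearCombination {Y : Fin 2 → ℝ → Fin 2 → ℂ}
    (hY : ∀ i, IsSolution q lam (Y i)) (v : Fin 2 → ℂ) :
    IsSolution q lam (fun x => ∑ i, v i • Y i x) ∧
      dHalf (fun x => ∑ i, v i • Y i x) 0 = ∑ i, v i • dHalf (Y i) 0 := by
  simp only [Fin.sum_univ_two]
  refine ⟨((hY 0).smul _).add ((hY 1).smul _), ?_⟩
  rw [((hY 0).smul _).dHalf_add ((hY 1).smul _) le_rfl, (hY 0).dHalf_smul _ le_rfl,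
    (hY 1).dHalf_smul _ le_rfl]

theorem absolutelyContinuousOnInterval_apply {f : ℝ → Fin 2 → ℂ} {a b : ℝ}
    (hf : AbsolutelyContinuousOnInterval f a b) (i : Fin 2) :
    AbsolutelyContinuousOnInterval (fun x => f x i) a b :=
  squeeze_zero (fun _ => Finset.sum_nonneg fun _ _ => dist_nonneg)
    (fun _ => Finset.sum_le_sum fun _ _ => dist_le_pi_dist _ _ i) hf

theorem absolutelyContinuousOnInterval_dotProduct {f g : ℝ → Fin 2 → ℂ} {a b : ℝ}
    (hf : AbsolutelyContinuousOnInterval f a b) (hg : AbsolutelyContinuousOnInterval g a b) :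
    AbsolutelyContinuousOnInterval (fun x => f x ⬝ᵥ g x) a b := by
  simp only [dotProduct, Fin.sum_univ_two]
  have h := fun i => (absolutelyContinuousOnInterval_apply hf i).fun_smul
    (absolutelyContinuousOnInterval_apply hg i)
  exact (h 0).fun_add (h 1)

theorem hasDerivAt_dotProduct {f g : ℝ → Fin 2 → ℂ} {f' g' : Fin 2 → ℂ} {x : ℝ}
    (hf : HasDerivAt f f' x) (hg : HasDerivAt g g' x) :
    HasDerivAt (fun x => f x ⬝ᵥ g x) (f' ⬝ᵥ g x + f x ⬝ᵥ g') x := by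
  rw [hasDerivAt_pi] at hf hg
  simp only [dotProduct, ← Finset.sum_add_distrib]
  exact HasDerivAt.fun_sum fun i _ => (hf i).mul (hg i)

theorem norm_dotProduct_le (v w : Fin 2 → ℂ) : ‖v ⬝ᵥ w‖ ≤ 2 * (‖v‖ * ‖w‖) := by
  have h : ∀ i, ‖v i * w i‖ ≤ ‖v‖ * ‖w‖ := fun i => by
    rw [norm_mul]
    gcongr <;> exact norm_le_pi_norm _ i
  rw [dotProduct, Fin.sum_univ_two, two_mul]
  exact (norm_add_le _ _).trans (add_le_add (h 0) (h 1))

/-- The Wronskian of two solutions is constant. -/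
theorem IsSolution.wronskian_eq (hF : IsSolution q lam F) (hG : IsSolution q lam G) {x : ℝ}
    (hx : 0 ≤ x) : F x ⬝ᵥ dHalf G x - dHalf F x ⬝ᵥ G x = F 0 ⬝ᵥ dHalf G 0 - dHalf F 0 ⬝ᵥ G 0 := by
  obtain rfl | hx := hx.eq_or_lt
  · rfl
  have hac : AbsolutelyContinuousOnInterval
      (fun x => F x ⬝ᵥ dHalf G x - dHalf F x ⬝ᵥ G x) 0 x :=
    (absolutelyContinuousOnInterval_dotProduct (hF.absCont x hx) (hG.absCont_deriv x hx)).fun_sub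
      (absolutelyContinuousOnInterval_dotProduct (hF.absCont_deriv x hx) (hG.absCont x hx))
  obtain ⟨C, hC⟩ := hac.const_of_ae_hasDerivAt_zero (by
    -- The equation is available only for `t > 0`, so the left endpoint is discarded as a null set.
    have h0 : ∀ᵐ t : ℝ, t ≠ 0 := by simp [ae_iff, measure_singleton]
    filter_upwards [h0, (ae_restrict_iff' measurableSet_Ioi).1 hF.equation,
      (ae_restrict_iff' measurableSet_Ioi).1 hG.equation] with t ht hFt hGt htx
    rw [Set.uIcc_of_le hx.le] at htx
    have htp : 0 < t := lt_of_le_of_ne htx.1 ht.symm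
    obtain ⟨F₂, hF1, hF2⟩ := hFt htp
    obtain ⟨G₂, hG1, hG2⟩ := hGt htp
    refine ((hasDerivAt_dotProduct (hF.hasDerivAt htp) hG1).sub
      (hasDerivAt_dotProduct hF1 (hG.hasDerivAt htp))).congr_deriv ?_
    rw [potential_mulVec, eps_mulVec, eps_mulVec, coef_apply] at hF2 hG2
    have f0 := congrFun hF2 0
    have f1 := congrFun hF2 1
    have g0 := congrFun hG2 0
    have g1 := congrFun hG2 1
    simp at f0 f1 g0 g1
    simp only [dotProduct, Fin.sum_univ_two]
    -- Both `εQ` and `ε` are symmetric, so their contributions to `F·G'' - F''·G` cancel. No complex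
    -- conjugation enters, hence complex `λ` is harmless.
    linear_combination G t 0 * f1 + G t 1 * f0 - F t 0 * g1 - F t 1 * g0)
  exact (hC x Set.right_mem_uIcc).trans (hC 0 Set.left_mem_uIcc).symm

theorem IsSolution.continuousOn (hF : IsSolution q lam F) {b : ℝ} (hb : 0 < b) :
    ContinuousOn F (Set.Icc 0 b) := by
  simpa [Set.uIcc_of_le hb.le] using (hF.absCont b hb).continuousOn

theorem IsSolution.continuousOn_dHalf (hF : IsSolution q lam F) {b : ℝ} (hb : 0 < b) :
    ContinuousOn (dHalf F) (Set.Icc 0 b) := by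
  simpa [Set.uIcc_of_le hb.le] using (hF.absCont_deriv b hb).continuousOn

theorem continuousOn_dotProduct {f g : ℝ → Fin 2 → ℂ} {s : Set ℝ} (hf : ContinuousOn f s)
    (hg : ContinuousOn g s) : ContinuousOn (fun x => f x ⬝ᵥ g x) s := by
  rw [continuousOn_pi] at hf hg
  simp only [dotProduct]
  exact continuousOn_finsetSum _ fun i _ => (hf i).mul (hg i)

/-- Square integrability of `F` says nothing directly about `F'`. Averaging the constant Wronskian
against `t(R - t)`, which vanishes at both ends and has integral `R³/6`, moves the derivative off
`F` without boundary terms. -/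
theorem IsSolution.wronskian_mul_eq_integral (hF : IsSolution q lam F)
    (hG : IsSolution q lam G) {R : ℝ} (hR : 0 < R) :
    (R : ℂ) ^ 3 / 6 * (F 0 ⬝ᵥ dHalf G 0 - dHalf F 0 ⬝ᵥ G 0) =
      ∫ t in (0 : ℝ)..R, (2 * ((t : ℂ) * (R - t)) * (F t ⬝ᵥ dHalf G t) +
        (R - 2 * t) * (F t ⬝ᵥ G t)) := by
  set W := F 0 ⬝ᵥ dHalf G 0 - dHalf F 0 ⬝ᵥ G 0 with hW
  have hFc := hF.continuousOn hR
  have hGc := hG.continuousOn hR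
  have hGc' := hG.continuousOn_dHalf hR
  have hc : ∀ p : ℝ → ℂ, Continuous p → ContinuousOn p (Set.Icc 0 R) := fun p hp => hp.continuousOn
  have := intervalIntegral.integral_eq_sub_of_hasDerivAt_of_le hR.le
    (f := fun t : ℝ => ((R : ℂ) * t ^ 2 / 2 - t ^ 3 / 3) * W + (t * (R - t)) * (F t ⬝ᵥ G t))
    (f' := fun t : ℝ => 2 * ((t : ℂ) * (R - t)) * (F t ⬝ᵥ dHalf G t) +
        (R - 2 * t) * (F t ⬝ᵥ G t))
    ((hc _ (by fun_prop)).add ((hc _ (by fun_prop)).mul (continuousOn_dotProduct hFc hGc)))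
    (fun t ht => ?_)
    (ContinuousOn.intervalIntegrable (by
      rw [Set.uIcc_of_le hR.le]
      exact ((hc _ (by fun_prop)).mul (continuousOn_dotProduct hFc hGc')).add
        ((hc _ (by fun_prop)).mul (continuousOn_dotProduct hFc hGc))))
  · rw [this]
    push_cast
    ring
  · have hid : HasDerivAt (fun t : ℝ => (t : ℂ)) 1 t := (hasDerivAt_id (t : ℂ)).comp_ofReal
    have h1 := ((((hid.pow 2).const_mul (R : ℂ)).div_const 2).sub
      ((hid.pow 3).div_const 3)).mul_const W
    have h2 := (hid.mul (hid.const_sub (R : ℂ))).mul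
      (hasDerivAt_dotProduct (hF.hasDerivAt ht.1) (hG.hasDerivAt ht.1))
    refine (h1.add h2).congr_deriv ?_
    have hWt := hF.wronskian_eq hG ht.1.le
    rw [← hW] at hWt
    rw [← hWt]
    simp
    ring

/-- A square integrable solution has vanishing Wronskian with every solution that is bounded
together with its derivative. -/
theorem IsSolution.wronskian_eq_zero (hF : IsSolution q lam F) (hG : IsSolution q lam G)
    (hF2 : MemLp F 2 (volume.restrict (Set.Ioi 0))) {C : ℝ}
    (hC : ∀ x : ℝ, 0 ≤ x → ‖G x‖ ≤ C ∧ ‖dHalf G x‖ ≤ C) :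
    F 0 ⬝ᵥ dHalf G 0 = dHalf F 0 ⬝ᵥ G 0 := by
  rw [← sub_eq_zero, ← norm_le_zero_iff]
  set W := F 0 ⬝ᵥ dHalf G 0 - dHalf F 0 ⬝ᵥ G 0 with hW
  have hC0 : 0 ≤ C := (norm_nonneg _).trans (hC 0 le_rfl).1
  have hsq : IntegrableOn (fun x => ‖F x‖ ^ 2) (Set.Ioi 0) :=
    (memLp_two_iff_integrable_sq_norm hF2.1).1 hF2
  set K := ∫ x in Set.Ioi 0, ‖F x‖ ^ 2 with hK
  have hK0 : 0 ≤ K := integral_nonneg fun _ => sq_nonneg _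
  -- Taking `R = n²`, the averaged identity has left side `n⁶‖W‖/6` and right side at most `6Cn⁵(1 +
  -- K)`. Letting `n` grow forces `W = 0`.
  have key : ∀ n : ℝ, 1 ≤ n → ‖W‖ * n ≤ 36 * C * (1 + K) := fun n hn => by
    have hn0 : 0 < n := by linarith
    have hR : 0 < n ^ 2 := by positivity
    have hR1 : 1 ≤ n ^ 2 := one_le_pow₀ hn
    have hsqi : IntervalIntegrable (fun x => ‖F x‖ ^ 2) volume 0 (n ^ 2) :=
      (intervalIntegrable_iff_integrableOn_Ioc_of_le hR.le).2
        (hsq.mono_set Set.Ioc_subset_Ioi_self)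
    have hb : ‖((n ^ 2 : ℝ) : ℂ) ^ 3 / 6 * W‖ ≤
        ∫ t in (0 : ℝ)..n ^ 2, 6 * C * n ^ 4 * (n⁻¹ + n * ‖F t‖ ^ 2) := by
      rw [hW, hF.wronskian_mul_eq_integral hG hR]
      refine intervalIntegral.norm_integral_le_of_norm_le hR.le (.of_forall fun t ht => ?_)
        ((intervalIntegrable_const.add (hsqi.const_mul n)).const_mul _)
      have ht0 := ht.1.le
      have h1 : ‖(F t ⬝ᵥ dHalf G t)‖ ≤ 2 * (‖F t‖ * C) :=
        (norm_dotProduct_le _ _).trans (by gcongr; exact (hC t ht0).2)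
      have h2 : ‖(F t ⬝ᵥ G t)‖ ≤ 2 * (‖F t‖ * C) :=
        (norm_dotProduct_le _ _).trans (by gcongr; exact (hC t ht0).1)
      have h3 : ‖2 * ((t : ℂ) * ((n ^ 2 : ℝ) - t))‖ ≤ 2 * n ^ 4 := by
        rw [← Complex.ofReal_sub, ← Complex.ofReal_mul, norm_mul, Complex.norm_real,
          Complex.norm_ofNat, Real.norm_of_nonneg (mul_nonneg ht0 (sub_nonneg.2 ht.2))]
        have : t * (n ^ 2 - t) ≤ n ^ 2 * n ^ 2 :=
          mul_le_mul ht.2 (by linarith) (sub_nonneg.2 ht.2) hR.le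
        linarith [show n ^ 4 = n ^ 2 * n ^ 2 by ring]
      have h4 : ‖(((n ^ 2 : ℝ) : ℂ) - 2 * t)‖ ≤ n ^ 4 := by
        have e : (((n ^ 2 : ℝ) : ℂ) - 2 * t) = ((n ^ 2 - 2 * t : ℝ) : ℂ) := by push_cast; ring
        rw [e, Complex.norm_real, Real.norm_eq_abs, abs_le]
        have : n ^ 2 ≤ n ^ 4 := pow_le_pow_right₀ hn (by norm_num)
        constructor <;> linarith [ht.2]
      -- The weights `1/n` and `n` balance: over `[0, n²]` both terms integrate to `O(n)`.
      have h5 : ‖F t‖ ≤ n⁻¹ + n * ‖F t‖ ^ 2 := by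
        have : 0 ≤ (n * ‖F t‖ - 1) ^ 2 * n⁻¹ := by positivity
        have e : (n * ‖F t‖ - 1) ^ 2 * n⁻¹ = n * ‖F t‖ ^ 2 - 2 * ‖F t‖ + n⁻¹ := by field_simp; ring
        linarith [norm_nonneg (F t)]
      calc _ ≤ 2 * n ^ 4 * (2 * (‖F t‖ * C)) + n ^ 4 * (2 * (‖F t‖ * C)) := by
            refine (norm_add_le _ _).trans (add_le_add ?_ ?_) <;> rw [norm_mul] <;> gcongr
        _ = 6 * C * n ^ 4 * ‖F t‖ := by ring
        _ ≤ _ := by gcongr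
    have hi : ∫ t in (0 : ℝ)..n ^ 2, ‖F t‖ ^ 2 ≤ K := by
      rw [intervalIntegral.integral_of_le hR.le]
      exact setIntegral_mono_set hsq (.of_forall fun _ => sq_nonneg _)
        (.of_forall fun _ h => Set.Ioc_subset_Ioi_self h)
    rw [intervalIntegral.integral_const_mul, intervalIntegral.integral_add
      intervalIntegrable_const (hsqi.const_mul n), intervalIntegral.integral_const_mul,
      intervalIntegral.integral_const, norm_mul, norm_div, norm_pow, Complex.norm_real,
      Real.norm_of_nonneg hR.le, Complex.norm_ofNat, smul_eq_mul, sub_zero] at hb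
    have h6 : (n ^ 2) ^ 3 / 6 * ‖W‖ ≤ 6 * C * n ^ 4 * (n ^ 2 * n⁻¹ + n * K) := hb.trans (by gcongr)
    have h7 : (n ^ 2) ^ 3 / 6 * ‖W‖ = n ^ 5 / 6 * (‖W‖ * n) := by ring
    have h8 : 6 * C * n ^ 4 * (n ^ 2 * n⁻¹ + n * K) = n ^ 5 / 6 * (36 * C * (1 + K)) := by
      field_simp
      ring
    rw [h7, h8] at h6
    exact le_of_mul_le_mul_left h6 (by positivity)
  by_contra! hpos
  obtain ⟨N, hN⟩ := exists_nat_gt (36 * C * (1 + K) / ‖W‖)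
  have h1 := key (max N 1) (le_max_right _ _)
  rw [div_lt_iff₀ hpos] at hN
  have h2 : ‖W‖ * N ≤ ‖W‖ * max (N : ℝ) 1 := by
    gcongr
    exact le_max_left _ _
  linarith

end Wronskian

/-! ### Dirichlet-to-Neumann matrix and Weyl matrix. -/

section Weyl

variable {q : ℝ → ℂ}

/-- `m` maps `F(0)` to `F'(0)` for the square integrable solutions `F`. -/
structure IsDirichletToNeumann (q : ℝ → ℂ) (lam : ℂ) (m : Matrix (Fin 2) (Fin 2) ℂ) : Prop where
  dHalf_eq : ∀ F, IsSolution q lam F → MemLp F 2 (volume.restrict (Set.Ioi 0)) →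
    dHalf F 0 = m *ᵥ F 0
  exists_eq : ∀ v, ∃ F, IsSolution q lam F ∧ MemLp F 2 (volume.restrict (Set.Ioi 0)) ∧ F 0 = v

theorem exists_isDirichletToNeumann (hq : IntegrableOn q (Set.Ioi 0)) :
    ∃ r : ℂ → Matrix (Fin 2) (Fin 2) ℂ, ContinuousOn r (quadrant (radius q)) ∧
      Tendsto r (Bornology.cobounded ℂ ⊓ 𝓟 (quadrant (radius q))) (𝓝 0) ∧
      ∀ k ∈ quadrant (radius q), 0 < k.re → 0 < k.im →
        IsDirichletToNeumann q (k ^ 2) (k • T + r k) := by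
  classical
  choose F hF using fun j : Fin 2 => exists_isJost hq (Pi.single j 1)
  let r : quadrant (radius q) → Matrix (Fin 2) (Fin 2) ℂ := fun k =>
    Matrix.of fun i j => -jostCorr q (F j) k i
  have hrc : Continuous r := continuous_matrix fun i j =>
    ((continuous_apply i).comp ((hF j).continuous_jostCorr hq)).neg
  have hrt : Tendsto r (quadrantAtInfinity q) (𝓝 0) := by
    refine tendsto_pi_nhds.2 fun i => tendsto_pi_nhds.2 fun j => ?_
    simpa [r] using ((continuous_apply i).tendsto _ |>.comp ((hF j).tendsto_jostCorr hq)).neg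
  let r' : ℂ → Matrix (Fin 2) (Fin 2) ℂ := fun k =>
    if h : k ∈ quadrant (radius q) then r ⟨k, h⟩ else 0
  have hr' : ∀ k : quadrant (radius q), r' k = r k := fun k => dif_pos k.2
  refine ⟨r', ?_, ?_, fun k hk h1 h2 => ⟨fun G hG hG2 => ?_, fun v => ?_⟩⟩
  · rw [continuousOn_iff_continuous_domRestrict]
    exact hrc.congr fun k => (hr' k).symm
  · rw [← subtype_coe_map_comap, tendsto_map'_iff]
    exact hrt.congr fun k => (hr' k).symm
  · set K : quadrant (radius q) := ⟨k, hk⟩ with hK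
    have hm : ∀ j, dHalf (jostSol q (Pi.single j 1) (F j) K) 0 = (k • T + r' k).col j := fun j => by
      rw [(hF j).dHalf_jostSol_zero hq K, mulVec_single_one]
      ext i
      have := hr' K
      simp only [hK] at this
      simp [this, r, hK, sub_eq_add_neg]
    -- Vanishing Wronskians with the two Jost solutions give `G'(0) = mᵀG(0)`, with the transpose.
    have hw : ∀ G, IsSolution q (k ^ 2) G → MemLp G 2 (volume.restrict (Set.Ioi 0)) →
        ∀ j, dHalf G 0 j = G 0 ⬝ᵥ (k • T + r' k).col j := fun G hG hG2 j => by
      obtain ⟨C, hC⟩ := (hF j).exists_bound hq K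
      have := hG.wronskian_eq_zero ((hF j).isSolution hq K) hG2 hC
      rw [hm, IsJost.jostSol_zero, dotProduct_single_one] at this
      exact this.symm
    -- The Jost solutions are themselves square integrable, so the relation just found applies to
    -- them and shows that `m` is symmetric.
    have hsymm : ∀ i j, (k • T + r' k) i j = (k • T + r' k) j i := fun i j => by
      have := hw _ ((hF j).isSolution hq K) ((hF j).memLp hq K h1 h2) i
      rw [hm, IsJost.jostSol_zero, single_one_dotProduct] at this
      exact this
    ext j
    rw [hw G hG hG2 j, dotProduct_comm]
    simp only [mulVec, dotProduct, Matrix.col_apply]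
    exact Finset.sum_congr rfl fun i _ => by rw [hsymm]
  · obtain ⟨f, hf⟩ := exists_isJost hq v
    exact ⟨_, hf.isSolution hq ⟨k, hk⟩, hf.memLp hq ⟨k, hk⟩ h1 h2, IsJost.jostSol_zero _⟩

/-- `L_α` as a function of the Cauchy data. -/
def dataL (α : OnePoint ℂ) (u u' : Fin 2 → ℂ) : Fin 2 → ℂ :=
  α.elim u' fun a => (√(1 + ‖a‖ ^ 2))⁻¹ • ((bdryMatrix a).map conj *ᵥ u' - u)

/-- `L_α^⊥` as a function of the Cauchy data. -/
def dataLperp (α : OnePoint ℂ) (u u' : Fin 2 → ℂ) : Fin 2 → ℂ :=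
  α.elim u fun a => (√(1 + ‖a‖ ^ 2))⁻¹ • (u' + bdryMatrix a *ᵥ u)

theorem bdryL_eq (α : OnePoint ℂ) (F : ℝ → Fin 2 → ℂ) :
    bdryL α F = dataL α (F 0) (dHalf F 0) := rfl

theorem bdryLperp_eq (α : OnePoint ℂ) (F : ℝ → Fin 2 → ℂ) :
    bdryLperp α F = dataLperp α (F 0) (dHalf F 0) := rfl

theorem dataL_add (α : OnePoint ℂ) (u u' v v' : Fin 2 → ℂ) :
    dataL α (u + v) (u' + v') = dataL α u u' + dataL α v v' := by
  induction α using OnePoint.rec with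
  | infty => rfl
  | coe a =>
    simp only [dataL, OnePoint.elim_some, mulVec_add, ← smul_add]
    congr 1
    abel

theorem dataL_smul (α : OnePoint ℂ) (c : ℂ) (u u' : Fin 2 → ℂ) :
    dataL α (c • u) (c • u') = c • dataL α u u' := by
  induction α using OnePoint.rec with
  | infty => rfl
  | coe a => simp only [dataL, OnePoint.elim_some, mulVec_smul, ← smul_sub, smul_comm c]

theorem dataLperp_add (α : OnePoint ℂ) (u u' v v' : Fin 2 → ℂ) :
    dataLperp α (u + v) (u' + v') = dataLperp α u u' + dataLperp α v v' := by
  induction α using OnePoint.rec with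
  | infty => rfl
  | coe a =>
    simp only [dataLperp, OnePoint.elim_some, mulVec_add, ← smul_add]
    congr 1
    abel

theorem dataLperp_smul (α : OnePoint ℂ) (c : ℂ) (u u' : Fin 2 → ℂ) :
    dataLperp α (c • u) (c • u') = c • dataLperp α u u' := by
  induction α using OnePoint.rec with
  | infty => rfl
  | coe a => simp only [dataLperp, OnePoint.elim_some, mulVec_smul, ← smul_add, smul_comm c]

theorem IsSolution.bdryL_add {lam : ℂ} {F G : ℝ → Fin 2 → ℂ} (hF : IsSolution q lam F)
    (hG : IsSolution q lam G) (α : OnePoint ℂ) :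
    bdryL α (fun x => F x + G x) = bdryL α F + bdryL α G := by
  rw [bdryL_eq, hF.dHalf_add hG le_rfl, dataL_add, ← bdryL_eq, ← bdryL_eq]

theorem IsSolution.bdryLperp_add {lam : ℂ} {F G : ℝ → Fin 2 → ℂ} (hF : IsSolution q lam F)
    (hG : IsSolution q lam G) (α : OnePoint ℂ) :
    bdryLperp α (fun x => F x + G x) = bdryLperp α F + bdryLperp α G := by
  rw [bdryLperp_eq, hF.dHalf_add hG le_rfl, dataLperp_add, ← bdryLperp_eq, ← bdryLperp_eq]

theorem sqrt_one_add_norm_sq_pos (a : ℂ) : 0 < √(1 + ‖a‖ ^ 2) := by positivity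

theorem map_conj_bdryMatrix_mulVec_mulVec (a : ℂ) (v : Fin 2 → ℂ) :
    (bdryMatrix a).map conj *ᵥ (bdryMatrix a *ᵥ v) = (‖a‖ : ℂ) ^ 2 • v := by
  ext i
  fin_cases i <;> simp [bdryMatrix, mulVec, dotProduct, ← mul_assoc, Complex.mul_conj',
    Complex.conj_mul']

theorem exists_cauchyData_phi (α : OnePoint ℂ) (v : Fin 2 → ℂ) :
    ∃ u u', dataL α u u' = -v ∧ dataLperp α u u' = 0 := by
  induction α using OnePoint.rec with
  | infty => exact ⟨0, -v, rfl, rfl⟩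
  | coe a =>
    have hs := sqrt_one_add_norm_sq_pos a
    have hsq : (√(1 + ‖a‖ ^ 2)) ^ 2 = 1 + ‖a‖ ^ 2 := Real.sq_sqrt (by positivity)
    simp only [dataL, dataLperp, OnePoint.elim_some]
    set s := √(1 + ‖a‖ ^ 2)
    refine ⟨s⁻¹ • v, -(bdryMatrix a *ᵥ (s⁻¹ • v)), ?_, ?_⟩
    · rw [mulVec_neg, map_conj_bdryMatrix_mulVec_mulVec, ← Complex.ofReal_pow,
        Complex.coe_smul, eq_sub_of_add_eq' hsq.symm]
      rw [smul_smul, ← neg_smul, ← sub_smul, smul_smul, ← neg_one_smul ℝ v]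
      congr 1
      field_simp
      ring
    · simp

theorem exists_isPhi (hq : IntegrableOn q (Set.Ioi 0)) {k : ℂ} (hk : radius q ≤ ‖k‖)
    (α : OnePoint ℂ) : ∃ Phi, IsPhi q α (k ^ 2) Phi := by
  choose u u' h1 h2 using fun j : Fin 2 => exists_cauchyData_phi α
    ((1 : Matrix (Fin 2) (Fin 2) ℂ).col j)
  choose Y hY hY0 hY1 using fun j => exists_isSolution_of_radius_le hq hk (u j) (u' j)
  refine ⟨fun x => Matrix.of fun i j => Y j x i, fun j => ?_⟩
  have : colFun (fun x => Matrix.of fun i j => Y j x i) j = Y j := rfl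
  rw [this, bdryL_eq, bdryLperp_eq, hY0, hY1, h1, h2]
  exact ⟨hY j, rfl, rfl⟩

theorem colFun_mul_eq (Phi : ℝ → Matrix (Fin 2) (Fin 2) ℂ) (M : Matrix (Fin 2) (Fin 2) ℂ)
    (j : Fin 2) (x : ℝ) : (Phi x * M).col j = ∑ i, M i j • colFun Phi i x := by
  ext l
  simp [colFun, Matrix.mul_apply, mul_comm]

theorem sum_smul_col_one (M : Matrix (Fin 2) (Fin 2) ℂ) (j : Fin 2) :
    ∑ i, M i j • (1 : Matrix (Fin 2) (Fin 2) ℂ).col i = M.col j := by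
  ext l
  fin_cases l <;> simp [Fin.sum_univ_two]

theorem IsPhi.linearCombination {α : OnePoint ℂ} {lam : ℂ} {Phi : ℝ → Matrix (Fin 2) (Fin 2) ℂ}
    (h : IsPhi q α lam Phi) (M : Matrix (Fin 2) (Fin 2) ℂ) (j : Fin 2) :
    IsSolution q lam (fun x => (Phi x * M).col j) ∧
      bdryL α (fun x => (Phi x * M).col j) = -M.col j ∧
      bdryLperp α (fun x => (Phi x * M).col j) = 0 := by
  simp_rw [colFun_mul_eq]
  obtain ⟨h1, h2⟩ := IsSolution.linearCombination (fun i => (h i).1) fun i => M i j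
  refine ⟨h1, ?_, ?_⟩
  · rw [bdryL_eq, h2, Fin.sum_univ_two, Fin.sum_univ_two, dataL_add, dataL_smul, dataL_smul,
      ← bdryL_eq, ← bdryL_eq, (h 0).2.1, (h 1).2.1, ← sum_smul_col_one M, Fin.sum_univ_two]
    ext l
    fin_cases l <;> simp
  · rw [bdryLperp_eq, h2, Fin.sum_univ_two, Fin.sum_univ_two, dataLperp_add, dataLperp_smul,
      dataLperp_smul, ← bdryLperp_eq, ← bdryLperp_eq, (h 0).2.2, (h 1).2.2]
    simp

/-- The columns of `X = Θ - ΦM` have boundary values `L_α(X) = M` and `L_α^⊥(X) = ε`, which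
eliminates `Φ` and `Θ`. Conversely only `Φ` must be constructed, since `Θ` is recovered as `X + ΦM`.
-/
theorem isWeylMatrix_iff (hq : IntegrableOn q (Set.Ioi 0)) {k : ℂ} (hk : radius q ≤ ‖k‖)
    (α : OnePoint ℂ) (M : Matrix (Fin 2) (Fin 2) ℂ) :
    IsWeylMatrix q α (k ^ 2) M ↔ ∀ j, ∃ X, IsSolution q (k ^ 2) X ∧
      MemLp X 2 (volume.restrict (Set.Ioi 0)) ∧ bdryL α X = M.col j ∧
      bdryLperp α X = eps.col j := by
  constructor
  · rintro ⟨Phi, Theta, hPhi, hTheta, hL2⟩ j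
    have hP := hPhi.linearCombination (-M) j
    refine ⟨fun x => colFun Theta j x + (Phi x * -M).col j, (hTheta j).1.add hP.1, ?_, ?_, ?_⟩
    · convert hL2 j using 1
      ext x i
      simp [colFun, sub_eq_add_neg]
    · rw [(hTheta j).1.bdryL_add hP.1, (hTheta j).2.1, hP.2.1, zero_add]
      ext i
      simp
    · rw [(hTheta j).1.bdryLperp_add hP.1, (hTheta j).2.2, hP.2.2, add_zero]
  · intro h
    choose X hX hX2 hXL hXp using h
    obtain ⟨Phi, hPhi⟩ := exists_isPhi hq hk α
    have hT : ∀ j, colFun (fun x => Matrix.of (fun i j => X j x i) + Phi x * M) j =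
        fun x => X j x + (Phi x * M).col j := fun j => rfl
    refine ⟨Phi, fun x => Matrix.of (fun i j => X j x i) + Phi x * M, hPhi, fun j => ?_,
      fun j => ?_⟩
    · have hP := hPhi.linearCombination M j
      rw [hT]
      refine ⟨(hX j).add hP.1, ?_, ?_⟩
      · rw [(hX j).bdryL_add hP.1, hXL, hP.2.1, add_neg_cancel]
      · rw [(hX j).bdryLperp_add hP.1, hXp, hP.2.2, add_zero]
    · convert hX2 j using 1
      ext x i
      simp [colFun]

theorem IsDirichletToNeumann.isWeylMatrix_iff (hq : IntegrableOn q (Set.Ioi 0)) {k : ℂ}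
    (hk : radius q ≤ ‖k‖) {m : Matrix (Fin 2) (Fin 2) ℂ} (hm : IsDirichletToNeumann q (k ^ 2) m)
    (α : OnePoint ℂ) (M : Matrix (Fin 2) (Fin 2) ℂ) :
    IsWeylMatrix q α (k ^ 2) M ↔ ∀ j, ∃ v, dataL α v (m *ᵥ v) = M.col j ∧
      dataLperp α v (m *ᵥ v) = eps.col j := by
  rw [HermitisedSchrodinger.isWeylMatrix_iff hq hk]
  refine forall_congr' fun j => ⟨?_, ?_⟩
  · rintro ⟨X, hX, hX2, h1, h2⟩
    rw [bdryL_eq, hm.dHalf_eq X hX hX2] at h1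
    rw [bdryLperp_eq, hm.dHalf_eq X hX hX2] at h2
    exact ⟨X 0, h1, h2⟩
  · rintro ⟨v, h1, h2⟩
    obtain ⟨X, hX, hX2, rfl⟩ := hm.exists_eq v
    rw [← hm.dHalf_eq X hX hX2] at h1 h2
    exact ⟨X, hX, hX2, h1, h2⟩

/-- The Titchmarsh–Weyl matrix in terms of the Dirichlet-to-Neumann matrix `m`. -/
def weylForm (α : OnePoint ℂ) (m : Matrix (Fin 2) (Fin 2) ℂ) : Matrix (Fin 2) (Fin 2) ℂ :=
  α.elim (m * eps) fun a =>
    eps * bdryMatrix a - (1 + (‖a‖ : ℂ) ^ 2) • ((m + bdryMatrix a)⁻¹ * eps)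

/-- The condition under which `weylForm` is the Titchmarsh–Weyl matrix. -/
def IsRegularAt (α : OnePoint ℂ) (m : Matrix (Fin 2) (Fin 2) ℂ) : Prop :=
  α.elim True fun a => (m + bdryMatrix a).det ≠ 0

theorem col_mul (A B : Matrix (Fin 2) (Fin 2) ℂ) (j : Fin 2) : (A * B).col j = A *ᵥ B.col j := rfl

theorem eps_mul_bdryMatrix (a : ℂ) : eps * bdryMatrix a = (bdryMatrix a).map conj * eps := by
  ext i j
  fin_cases i <;> fin_cases j <;> simp [eps, bdryMatrix, Matrix.mul_apply]

/-- For finite `α` with `s = √(1 + |α|²)`, the `L_α^⊥` condition forces `v = s(m + A)⁻¹ε`,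
columnwise. Substituting `mv = sε - Av` into `L_α` and using that the conjugate of `A` times `A` is
`|α|²` gives the formula; uniqueness is that of `v`. -/
theorem forall_exists_data_iff {α : OnePoint ℂ} {m : Matrix (Fin 2) (Fin 2) ℂ}
    (hm : IsRegularAt α m) (M : Matrix (Fin 2) (Fin 2) ℂ) :
    (∀ j, ∃ v, dataL α v (m *ᵥ v) = M.col j ∧ dataLperp α v (m *ᵥ v) = eps.col j) ↔
      M = weylForm α m := by
  have hcol : M = weylForm α m ↔ ∀ j, M.col j = (weylForm α m).col j :=
    ⟨fun h j => by rw [h], fun h => Matrix.ext fun i j => congrFun (h j) i⟩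
  rw [hcol]
  refine forall_congr' fun j => ?_
  induction α using OnePoint.rec with
  | infty =>
    refine ⟨?_, fun h => ⟨eps.col j, h.symm, rfl⟩⟩
    rintro ⟨v, h1, rfl : v = _⟩
    exact h1.symm
  | coe a =>
    have hu : IsUnit (m + bdryMatrix a).det := isUnit_iff_ne_zero.2 hm
    have hs := sqrt_one_add_norm_sq_pos a
    have hsq : (√(1 + ‖a‖ ^ 2)) ^ 2 = 1 + ‖a‖ ^ 2 := Real.sq_sqrt (by positivity)
    set s := √(1 + ‖a‖ ^ 2)
    have hsq' : (1 + (‖a‖ : ℂ) ^ 2) = ((s ^ 2 : ℝ) : ℂ) := by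
      rw [hsq]
      push_cast
      rfl
    have hperp : ∀ v, dataLperp (a : OnePoint ℂ) v (m *ᵥ v) = eps.col j ↔
        v = s • ((m + bdryMatrix a)⁻¹ *ᵥ eps.col j) := fun v => by
      simp only [dataLperp, OnePoint.elim_some]
      rw [← add_mulVec, inv_smul_eq_iff₀ hs.ne', ← mulVec_smul]
      constructor
      · intro h
        rw [← h, mulVec_mulVec, nonsing_inv_mul _ hu, one_mulVec]
      · rintro rfl
        rw [mulVec_mulVec, mul_nonsing_inv _ hu, one_mulVec]
    have hL : ∀ v, dataLperp (a : OnePoint ℂ) v (m *ᵥ v) = eps.col j →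
        dataL (a : OnePoint ℂ) v (m *ᵥ v) = (weylForm (a : OnePoint ℂ) m).col j := fun v hv => by
      have h1 : m *ᵥ v = s • eps.col j - bdryMatrix a *ᵥ v := by
        simp only [dataLperp, OnePoint.elim_some] at hv
        rw [← hv, smul_inv_smul₀ hs.ne', add_sub_cancel_right]
      have h2 := (hperp v).1 hv
      have h3 : (weylForm (a : OnePoint ℂ) m).col j =
          (bdryMatrix a).map conj *ᵥ eps.col j - s • v := by
        have : (weylForm (a : OnePoint ℂ) m).col j = ((bdryMatrix a).map conj * eps).col j -
            (1 + (‖a‖ : ℂ) ^ 2) • ((m + bdryMatrix a)⁻¹ * eps).col j := by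
          rw [← eps_mul_bdryMatrix]
          rfl
        rw [this, col_mul, col_mul, h2, hsq', Complex.coe_smul, smul_smul, sq]
      rw [h3]
      simp only [dataL, OnePoint.elim_some]
      rw [h1, mulVec_sub, map_conj_bdryMatrix_mulVec_mulVec, mulVec_smul, sub_sub,
        ← Complex.ofReal_pow, Complex.coe_smul, inv_smul_eq_iff₀ hs.ne', smul_sub, smul_smul,
        ← sq, hsq, add_smul, one_smul, add_comm v]
    constructor
    · rintro ⟨v, h1, h2⟩
      rw [← h1, hL v h2]
    · intro h
      have h2 := (hperp _).2 rfl
      exact ⟨_, (hL _ h2).trans h.symm, h2⟩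

theorem IsDirichletToNeumann.isWeylMatrix_iff_eq (hq : IntegrableOn q (Set.Ioi 0)) {k : ℂ}
    (hk : radius q ≤ ‖k‖) {m : Matrix (Fin 2) (Fin 2) ℂ} (hm : IsDirichletToNeumann q (k ^ 2) m)
    {α : OnePoint ℂ} (hα : IsRegularAt α m) (M : Matrix (Fin 2) (Fin 2) ℂ) :
    IsWeylMatrix q α (k ^ 2) M ↔ M = weylForm α m := by
  rw [hm.isWeylMatrix_iff hq hk, forall_exists_data_iff hα]

end Weyl

/-! ### Expansion of the Weyl matrix for `m = kT + r`, `r → 0`. -/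

section Asymptotics

theorem T_eq : T = !![(Complex.I - 1) / 2, (Complex.I + 1) / 2;
    (Complex.I + 1) / 2, (Complex.I - 1) / 2] := by
  ext i j
  fin_cases i <;> fin_cases j <;> simp [T, Pplus, Pminus] <;> ring

theorem eps_mul_eps : eps * eps = 1 := by
  ext i j
  fin_cases i <;> fin_cases j <;> simp [eps]

theorem T_mul_eps : T * eps = Complex.I • Pplus + Pminus := by
  rw [T_eq]
  ext i j
  fin_cases i <;> fin_cases j <;> simp [eps, Pplus, Pminus] <;> ring

theorem T_mul_eps_comm : T * eps = eps * T := by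
  rw [T_eq]
  ext i j
  fin_cases i <;> fin_cases j <;> simp [eps]

/-- Together with `ε² = 1` and `εT = Tε` this gives `T⁻¹ = -εT`, the source of every simplification
below. -/
theorem T_mul_T : T * T = -eps := by
  have := Complex.I_mul_I
  rw [T_eq]
  ext i j
  fin_cases i <;> fin_cases j <;> simp [eps] <;> linear_combination this / 2

theorem det_T_ne_zero : T.det ≠ 0 := by
  have h : T.det = -Complex.I := by
    rw [T_eq, det_fin_two_of]
    ring
  rw [h]
  simp

theorem continuousAt_inv_of_det_ne_zero {A : Matrix (Fin 2) (Fin 2) ℂ} (hA : A.det ≠ 0) :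
    ContinuousAt (fun B : Matrix (Fin 2) (Fin 2) ℂ => B⁻¹) A :=
  continuousAt_matrix_inv A (NormedRing.inverse_continuousAt (Units.mk0 _ hA))

variable {l : Filter ℂ} {r : ℂ → Matrix (Fin 2) (Fin 2) ℂ}

theorem tendsto_inv_smul_add (hl : l ≤ Bornology.cobounded ℂ) (hr : Tendsto r l (𝓝 0))
    (A : Matrix (Fin 2) (Fin 2) ℂ) :
    Tendsto (fun k => k⁻¹ • (k • T + r k + A)) l (𝓝 T) := by
  have h0 : Tendsto (fun k : ℂ => k⁻¹) l (𝓝 0) := (tendsto_inv₀_cobounded (α := ℂ)).mono_left hl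
  have h1 : Tendsto (fun k => T + k⁻¹ • (r k + A)) l (𝓝 (T + (0 : ℂ) • (0 + A))) :=
    tendsto_const_nhds.add (h0.smul (hr.add_const A))
  rw [zero_smul, add_zero] at h1
  refine h1.congr' ?_
  filter_upwards [hl (Bornology.eventually_ne_cobounded (0 : ℂ))] with k hk
  rw [add_assoc, smul_add k⁻¹ (k • T), inv_smul_smul₀ hk]

theorem eventually_det_ne_zero (hl : l ≤ Bornology.cobounded ℂ) (hr : Tendsto r l (𝓝 0))
    (A : Matrix (Fin 2) (Fin 2) ℂ) : ∀ᶠ k in l, (k • T + r k + A).det ≠ 0 := by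
  have h : Tendsto (fun k => (k⁻¹ • (k • T + r k + A)).det) l (𝓝 T.det) :=
    (continuous_id.matrix_det.tendsto T).comp (tendsto_inv_smul_add hl hr A)
  filter_upwards [h.eventually_ne det_T_ne_zero] with k hk h0
  rw [det_smul, h0, mul_zero] at hk
  exact hk rfl

theorem tendsto_inv_zero (hl : l ≤ Bornology.cobounded ℂ) (hr : Tendsto r l (𝓝 0))
    (A : Matrix (Fin 2) (Fin 2) ℂ) : Tendsto (fun k => (k • T + r k + A)⁻¹) l (𝓝 0) := by
  have h0 : Tendsto (fun k : ℂ => k⁻¹) l (𝓝 0) := (tendsto_inv₀_cobounded (α := ℂ)).mono_left hl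
  have h1 := h0.smul ((continuousAt_inv_of_det_ne_zero det_T_ne_zero).tendsto.comp
    (tendsto_inv_smul_add hl hr A))
  rw [zero_smul] at h1
  refine h1.congr' ?_
  filter_upwards [hl (Bornology.eventually_ne_cobounded (0 : ℂ)), eventually_det_ne_zero hl hr A]
    with k hk hd
  have e := Matrix.inv_smul' (k • T + r k + A) (Units.mk0 k⁻¹ (inv_ne_zero hk))
    (isUnit_iff_ne_zero.2 hd)
  simp only [Function.comp_apply]
  change k⁻¹ • (k⁻¹ • (k • T + r k + A))⁻¹ = _
  rw [Units.smul_def, Units.val_mk0] at e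
  rw [e, Units.smul_def, Units.val_inv_eq_inv_val, Units.val_mk0, smul_smul,
    mul_inv_cancel₀ (inv_ne_zero hk), one_smul]

/-- With `B = εT = -T⁻¹` and `X = (kT + S)⁻¹`, the resolvent identity is `kX = BSX - B`. Inserting
it into itself once gives the second-order expansion with an exact remainder. -/
theorem sq_smul_inv_eq {k : ℂ} {S : Matrix (Fin 2) (Fin 2) ℂ} (hd : (k • T + S).det ≠ 0) :
    k ^ 2 • (k • T + S)⁻¹ = -(k • (eps * T)) - eps * T * S * (eps * T) +
      eps * T * S * (eps * T) * S * (k • T + S)⁻¹ := by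
  set X := (k • T + S)⁻¹ with hX
  set B := eps * T with hB
  have hBT : B * T = -1 := by rw [hB, mul_assoc, T_mul_T, mul_neg, eps_mul_eps]
  have h1 : (k • T + S) * X = 1 := mul_nonsing_inv _ (isUnit_iff_ne_zero.2 hd)
  have h2 : k • X = B * S * X - B := by
    have := congrArg (B * ·) h1
    simp only [add_mul, mul_add, ← mul_assoc, mul_smul_comm, smul_mul_assoc, hBT, mul_one,
      neg_mul, one_mul, smul_neg] at this
    exact eq_sub_of_add_eq (neg_add_eq_iff_eq_add.1 this).symm
  rw [sq, mul_smul, h2, smul_sub, ← mul_smul_comm, h2, mul_sub]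
  simp only [mul_assoc]
  abel

/-- The explicit terms cancel exactly. What remains carries a factor `R` or the inverse matrix, and
both tend to `0`; this is where `r → 0` turns `O(1/k²)` into `o(1/k²)`. -/
theorem sq_smul_weylForm_sub_expansion {k : ℂ} (hk : k ≠ 0) {R : Matrix (Fin 2) (Fin 2) ℂ} (a : ℂ)
    (hd : (k • T + R + bdryMatrix a).det ≠ 0) :
    k ^ 2 • (weylForm (a : OnePoint ℂ) (k • T + R) - expansion a k) =
      (1 + (‖a‖ : ℂ) ^ 2) • (T * (eps * R) * T - eps * T * (R + bdryMatrix a) * (eps * T) *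
        (R + bdryMatrix a) * (k • T + R + bdryMatrix a)⁻¹ * eps) := by
  set c := 1 + (‖a‖ : ℂ) ^ 2 with hc
  set A := bdryMatrix a
  rw [add_assoc] at hd ⊢
  have hX := sq_smul_inv_eq hd
  have hw : weylForm (a : OnePoint ℂ) (k • T + R) =
      eps * A - c • ((k • T + (R + A))⁻¹ * eps) := by
    rw [← add_assoc]
    rfl
  rw [hw, expansion]
  set X := (k • T + (R + A))⁻¹
  have e1 : k ^ 2 • (eps * A - c • (X * eps) -
      (eps * A + (c / k) • T + (c / k ^ 2) • (T * (eps * A) * T))) =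
      -(c • ((k ^ 2 • X) * eps + k • T + T * (eps * A) * T)) := by
    have h1 : k ^ 2 * (c / k) = c * k := by field_simp
    have h2 : k ^ 2 * (c / k ^ 2) = c := by field_simp
    simp only [smul_sub, smul_add, smul_smul, h1, h2, smul_mul_assoc]
    rw [mul_comm c (k ^ 2)]
    abel
  have hTe : eps * T * eps = T := by
    rw [← T_mul_eps_comm, mul_assoc, eps_mul_eps, mul_one]
  rw [e1, hX, ← smul_neg]
  congr 1
  have e2 : (eps * T) * (R + A) * (eps * T) * eps = T * (eps * R) * T + T * (eps * A) * T := by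
    rw [mul_assoc, hTe, ← T_mul_eps_comm, mul_add, add_mul]
    simp only [mul_assoc]
  rw [add_mul, sub_mul, neg_mul, smul_mul_assoc, hTe, e2]
  abel

theorem tendsto_sq_smul_weylForm_sub_expansion (hl : l ≤ Bornology.cobounded ℂ)
    (hr : Tendsto r l (𝓝 0)) (a : ℂ) :
    Tendsto (fun k => k ^ 2 • (weylForm (a : OnePoint ℂ) (k • T + r k) - expansion a k)) l
      (𝓝 0) := by
  have hX := tendsto_inv_zero hl hr (bdryMatrix a)
  have hS := hr.add_const (bdryMatrix a)
  have h := (((tendsto_const_nhds (x := T)).mul ((tendsto_const_nhds (x := eps)).mul hr)).mul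
    (tendsto_const_nhds (x := T))).sub ((((((tendsto_const_nhds (x := eps * T)).mul hS).mul
      (tendsto_const_nhds (x := eps * T))).mul hS).mul hX).mul (tendsto_const_nhds (x := eps)))
  have h' := h.const_smul (1 + (‖a‖ : ℂ) ^ 2)
  simp only [mul_zero, zero_mul, sub_zero, smul_zero] at h'
  refine h'.congr' ?_
  filter_upwards [hl (Bornology.eventually_ne_cobounded (0 : ℂ)),
    eventually_det_ne_zero hl hr (bdryMatrix a)] with k hk hd
  exact (sq_smul_weylForm_sub_expansion hk a hd).symm

theorem tendsto_weylForm_infty_sub (hr : Tendsto r l (𝓝 0)) :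
    Tendsto (fun k => weylForm ∞ (k • T + r k) - k • (Complex.I • Pplus + Pminus)) l (𝓝 0) := by
  have h := hr.mul (tendsto_const_nhds (x := eps))
  rw [zero_mul] at h
  refine h.congr fun k => ?_
  change _ = (k • T + r k) * eps - _
  rw [add_mul, smul_mul_assoc, T_mul_eps, add_sub_cancel_left]

theorem eventually_isRegularAt (hl : l ≤ Bornology.cobounded ℂ) (hr : Tendsto r l (𝓝 0))
    (α : OnePoint ℂ) : ∀ᶠ k in l, IsRegularAt α (k • T + r k) := by
  induction α using OnePoint.rec with
  | infty => exact .of_forall fun _ => trivial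
  | coe a => exact eventually_det_ne_zero hl hr _

theorem continuousAt_weylForm {α : OnePoint ℂ} {m : Matrix (Fin 2) (Fin 2) ℂ}
    (hm : IsRegularAt α m) : ContinuousAt (weylForm α) m := by
  induction α using OnePoint.rec with
  | infty =>
    change ContinuousAt (fun m => m * eps) m
    fun_prop
  | coe a =>
    change ContinuousAt (fun m => eps * bdryMatrix a -
      (1 + (‖a‖ : ℂ) ^ 2) • ((m + bdryMatrix a)⁻¹ * eps)) m
    have h : ContinuousAt (fun m => (m + bdryMatrix a)⁻¹) m :=
      ContinuousAt.comp (f := fun m => m + bdryMatrix a) (continuousAt_inv_of_det_ne_zero hm)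
        (by fun_prop)
    fun_prop

end Asymptotics

/-! ### Passage to the real axis. -/

section BoundaryValue

variable {q : ℝ → ℂ} {r : ℂ → Matrix (Fin 2) (Fin 2) ℂ} {R : ℝ}

theorem weylMatrix_eq (hq : IntegrableOn q (Set.Ioi 0)) {k : ℂ}
    (hk : radius q ≤ ‖k‖) {m : Matrix (Fin 2) (Fin 2) ℂ} (hm : IsDirichletToNeumann q (k ^ 2) m)
    {α : OnePoint ℂ} (hα : IsRegularAt α m) : weylMatrix q α (k ^ 2) = weylForm α m :=
  (hm.isWeylMatrix_iff_eq hq hk hα _).1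
    (Classical.epsilon_spec ⟨_, (hm.isWeylMatrix_iff_eq hq hk hα _).2 rfl⟩)

theorem mem_closedSector_re_im {k : ℂ} (hk : k ∈ closedSector) (hk0 : k ≠ 0) :
    0 < k.re ∧ 0 ≤ k.im ∧ (0 < k.arg → 0 < k.im) := by
  have hn := norm_pos_iff.2 hk0
  have hpi := Real.pi_pos
  refine ⟨?_, ?_, fun h => ?_⟩
  · rw [← Complex.norm_mul_cos_arg]
    exact mul_pos hn (Real.cos_pos_of_mem_Ioo ⟨by linarith [hk.1], by linarith [hk.2]⟩)
  · exact Complex.arg_nonneg_iff.1 hk.1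
  · rw [← Complex.norm_mul_sin_arg]
    exact mul_pos hn (Real.sin_pos_of_pos_of_lt_pi h (by linarith [hk.2]))

theorem quadrant_subset (h : radius q ≤ R) : quadrant R ⊆ quadrant (radius q) :=
  fun _ hk => ⟨hk.1, hk.2.1, h.trans hk.2.2⟩

theorem eventually_mem_quadrant (R : ℝ) :
    ∀ᶠ k in sectorAtInfinity, k ∈ quadrant R ∧ 0 < k.re ∧ k ∈ closedSector := by
  filter_upwards [mem_inf_of_right (mem_principal_self _),
    mem_inf_of_left (Bornology.eventually_ne_cobounded (0 : ℂ)),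
    mem_inf_of_left (tendsto_norm_cobounded_atTop.eventually_ge_atTop R)] with k h1 h2 h3
  obtain ⟨h4, h5, -⟩ := mem_closedSector_re_im h1 h2
  exact ⟨⟨h4.le, h5, h3⟩, h4, h1⟩

theorem im_sq (k : ℂ) : (k ^ 2).im = 2 * (k.re * k.im) := by
  rw [sq, Complex.mul_im]
  ring

variable (hq : IntegrableOn q (Set.Ioi 0)) (hrc : ContinuousOn r (quadrant (radius q)))
  (hD : ∀ k ∈ quadrant (radius q), 0 < k.re → 0 < k.im →
    IsDirichletToNeumann q (k ^ 2) (k • T + r k))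
  (hR : radius q ≤ R) {α : OnePoint ℂ} (hα : ∀ k ∈ quadrant R, IsRegularAt α (k • T + r k))

include hq hrc hD hR hα in
theorem tendsto_weylMatrix_boundary {x : ℝ} (hx : R < x) :
    Tendsto (weylMatrix q α) (𝓝[{z : ℂ | 0 < z.im}] ((x : ℂ) ^ 2))
      (𝓝 (weylForm α ((x : ℂ) • T + r x))) := by
  have hx0 : 0 < x := (radius_pos q).trans_le (hR.trans hx.le)
  -- The principal square root is continuous at `x²` with value `x`. Near `x` its real part is
  -- positive, and `Im κ² = 2 Re κ Im κ > 0` then places it in the open first quadrant, where the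
  -- Weyl formula holds.
  let κ : ℂ → ℂ := fun z => z ^ (((2 : ℕ) : ℂ)⁻¹)
  have hκ2 : ∀ z, κ z ^ 2 = z := fun z => Complex.cpow_nat_inv_pow z two_ne_zero
  have hκx : κ ((x : ℂ) ^ 2) = x := by
    have harg := Complex.arg_ofReal_of_nonneg hx0.le
    have hpi := Real.pi_pos
    refine Complex.pow_cpow_nat_inv two_ne_zero ?_ ?_ <;> rw [harg] <;> push_cast <;> linarith
  have hκc : Tendsto κ (𝓝[{z : ℂ | 0 < z.im}] ((x : ℂ) ^ 2)) (𝓝 (x : ℂ)) := by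
    have hs : (x : ℂ) ^ 2 ∈ Complex.slitPlane := by
      rw [← Complex.ofReal_pow]
      exact Complex.ofReal_mem_slitPlane.2 (by positivity)
    have := (continuousAt_cpow_const (b := ((2 : ℕ) : ℂ)⁻¹) hs).tendsto
    change Tendsto κ _ (𝓝 (κ ((x : ℂ) ^ 2))) at this
    rw [hκx] at this
    exact this.mono_left nhdsWithin_le_nhds
  have hmem : ∀ᶠ z in 𝓝[{z : ℂ | 0 < z.im}] ((x : ℂ) ^ 2),
      κ z ∈ quadrant R ∧ 0 < (κ z).re ∧ 0 < (κ z).im := by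
    have h1 := hκc.eventually (Complex.continuous_re.continuousAt.eventually_const_lt
      (by simpa using hx0 : 0 < (x : ℂ).re))
    have h2 := hκc.eventually (continuous_norm.continuousAt.eventually_const_lt
      (by simpa [abs_of_pos hx0] using hx : R < ‖(x : ℂ)‖))
    filter_upwards [h1, h2, self_mem_nhdsWithin] with z h1 h2 h3
    have h4 : 0 < (κ z).im := by
      have : 0 < (κ z ^ 2).im := by
        rw [hκ2]
        exact h3
      rw [im_sq] at this
      exact pos_of_mul_pos_right (by linarith) h1.le
    exact ⟨⟨h1.le, h4.le, h2.le⟩, h1, h4⟩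
  have hxq : (x : ℂ) ∈ quadrant R :=
    ⟨by simpa using hx0.le, by simp, by simpa [abs_of_pos hx0] using hx.le⟩
  have hm : ContinuousWithinAt (fun k : ℂ => weylForm α (k • T + r k)) (quadrant R) x := by
    have hr : ContinuousWithinAt (fun k : ℂ => k • T + r k) (quadrant R) x :=
      (continuousWithinAt_id.smul continuousWithinAt_const).add
        ((hrc.mono (quadrant_subset hR)) x hxq)
    exact ContinuousAt.comp_continuousWithinAt (f := fun k : ℂ => k • T + r k)
      (continuousAt_weylForm (hα x hxq)) hr
  refine (hm.tendsto.comp (tendsto_nhdsWithin_iff.2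
    ⟨hκc, hmem.mono fun z hz => hz.1⟩)).congr' ?_
  filter_upwards [hmem] with z hz
  have := weylMatrix_eq hq (hR.trans hz.1.2.2) (hD _ (quadrant_subset hR hz.1) hz.2.1 hz.2.2)
    (hα _ hz.1)
  rw [hκ2] at this
  exact this.symm

theorem neBot_nhdsWithin_upperHalfPlane (x : ℝ) : (𝓝[{z : ℂ | 0 < z.im}] ((x : ℂ) ^ 2)).NeBot := by
  refine mem_closure_iff_nhdsWithin_neBot.1 ?_
  rw [Complex.closure_setOfPred_lt_im]
  change 0 ≤ ((x : ℂ) ^ 2).im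
  rw [im_sq]
  simp

include hq hrc hD hR hα in
theorem mFunction_ofReal_sq {x : ℝ} (hx : R < x) :
    mFunction q α ((x : ℂ) ^ 2) = weylForm α ((x : ℂ) • T + r x) := by
  have := neBot_nhdsWithin_upperHalfPlane x
  rw [mFunction, if_pos (by rw [im_sq]; simp)]
  exact (tendsto_weylMatrix_boundary hq hrc hD hR hα hx).limUnder_eq

include hq hrc hD hR hα in
theorem tendsto_mFunction_boundary {x : ℝ} (hx : R < x) :
    Tendsto (mFunction q α) (𝓝[{z : ℂ | 0 < z.im}] ((x : ℂ) ^ 2))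
      (𝓝 (mFunction q α ((x : ℂ) ^ 2))) := by
  rw [mFunction_ofReal_sq hq hrc hD hR hα hx]
  refine (tendsto_weylMatrix_boundary hq hrc hD hR hα hx).congr' ?_
  filter_upwards [self_mem_nhdsWithin] with z hz
  rw [mFunction, if_neg (ne_of_gt hz)]

include hq hrc hD hR hα in
-- One formula covers interior points, through the Weyl matrix itself, and the positive real axis,
-- through the boundary limit; hence the asymptotics need no separate treatment of `arg k = 0`.
theorem mFunction_sq_eq {k : ℂ} (hk : k ∈ quadrant R) (hkR : R < ‖k‖) (hre : 0 < k.re) :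
    mFunction q α (k ^ 2) = weylForm α (k • T + r k) := by
  obtain him | him := hk.2.1.eq_or_lt
  · have hkx : k = (k.re : ℂ) := Complex.ext rfl (by simp [← him])
    have hn : R < k.re := by
      rw [hkx] at hkR
      simpa [abs_of_pos hre] using hkR
    have := mFunction_ofReal_sq hq hrc hD hR hα hn
    rwa [← hkx] at this
  · have : (k ^ 2).im ≠ 0 := by
      rw [im_sq]
      positivity
    rw [mFunction, if_neg this]
    exact weylMatrix_eq hq (hR.trans hk.2.2) (hD k (quadrant_subset hR hk) hre him) (hα k hk)

end BoundaryValue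

/-! ### Assembly on the sector. -/

theorem sectorAtInfinity_le (R : ℝ) :
    sectorAtInfinity ≤ Bornology.cobounded ℂ ⊓ 𝓟 (quadrant R) :=
  le_inf inf_le_left (le_principal_iff.2 ((eventually_mem_quadrant R).mono fun _ hk => hk.1))

theorem exists_radius_isRegularAt {q : ℝ → ℂ} {r : ℂ → Matrix (Fin 2) (Fin 2) ℂ}
    (hr : Tendsto r (Bornology.cobounded ℂ ⊓ 𝓟 (quadrant (radius q))) (𝓝 0)) (α : OnePoint ℂ) :
    ∃ R, radius q ≤ R ∧ ∀ k ∈ quadrant R, IsRegularAt α (k • T + r k) := by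
  have h := eventually_inf_principal.1 (eventually_isRegularAt inf_le_left hr α)
  obtain ⟨R, -, hR⟩ := hasBasis_cobounded_norm.eventually_iff.1 h
  exact ⟨max R (radius q), le_max_right _ _, fun k hk =>
    hR ((le_max_left _ _).trans hk.2.2) (quadrant_subset (le_max_right _ _) hk)⟩

end HermitisedSchrodinger

end

theorem propositionC3 (q : ℝ → ℂ) (hq : IntegrableOn q (Set.Ioi 0)) :
    -- for large `k` the `M`-function is well defined, on the ray `arg k = 0` as a boundary value
    (∀ α : OnePoint ℂ,
      (∀ᶠ k in HermitisedSchrodinger.sectorAtInfinity, 0 < k.arg →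
        ∃! M, HermitisedSchrodinger.IsWeylMatrix q α (k ^ 2) M) ∧
      (∀ᶠ k : ℝ in atTop,
        Tendsto (HermitisedSchrodinger.mFunction q α) (𝓝[{z : ℂ | 0 < z.im}] ((k : ℂ) ^ 2))
          (𝓝 (HermitisedSchrodinger.mFunction q α ((k : ℂ) ^ 2))))) ∧
    -- the case `α ≠ ∞`
    (∀ (α : ℂ) (i j : Fin 2),
      (fun k : ℂ => HermitisedSchrodinger.mFunction q (α : OnePoint ℂ) (k ^ 2) i j
          - HermitisedSchrodinger.expansion α k i j)
        =o[HermitisedSchrodinger.sectorAtInfinity] fun k : ℂ => 1 / k ^ 2) ∧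
    -- the case `α = ∞`
    (∀ i j : Fin 2,
      (fun k : ℂ => HermitisedSchrodinger.mFunction q ∞ (k ^ 2) i j
          - (k • (Complex.I • HermitisedSchrodinger.Pplus + HermitisedSchrodinger.Pminus)) i j)
        =o[HermitisedSchrodinger.sectorAtInfinity] fun _ : ℂ => (1 : ℝ)) := by
  open HermitisedSchrodinger in
  obtain ⟨r, hrc, hrt, hD⟩ := exists_isDirichletToNeumann hq
  have hl : sectorAtInfinity ≤ Bornology.cobounded ℂ := inf_le_left
  have hr : Tendsto r sectorAtInfinity (𝓝 0) := hrt.mono_left (sectorAtInfinity_le _)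
  have hm : ∀ α : OnePoint ℂ, ∀ᶠ k in sectorAtInfinity,
      mFunction q α (k ^ 2) = weylForm α (k • T + r k) := fun α => by
    obtain ⟨R, hR, hα⟩ := exists_radius_isRegularAt hrt α
    filter_upwards [eventually_mem_quadrant R,
      hl (tendsto_norm_cobounded_atTop.eventually_gt_atTop R)] with k h1 h2
    exact mFunction_sq_eq hq hrc hD hR hα h1.1 h2 h1.2.1
  refine ⟨fun α => ?_, fun a i j => ?_, fun i j => ?_⟩
  · obtain ⟨R, hR, hα⟩ := exists_radius_isRegularAt hrt α
    refine ⟨?_, ?_⟩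
    · filter_upwards [eventually_mem_quadrant R] with k hk harg
      have him := (mem_closedSector_re_im hk.2.2
        (ne_zero_of_radius_le (hR.trans hk.1.2.2))).2.2 harg
      have hiff := (hD k (quadrant_subset hR hk.1) hk.2.1 him).isWeylMatrix_iff_eq hq
        (hR.trans hk.1.2.2) (hα k hk.1)
      exact ⟨_, (hiff _).2 rfl, fun M hM => (hiff M).1 hM⟩
    · filter_upwards [eventually_gt_atTop R] with x hx
      exact tendsto_mFunction_boundary hq hrc hD hR hα hx
  -- Dividing by `1/k²` is multiplying by `k²`, so the claim is the entrywise form of the matrix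
  -- limit already obtained.
  · rw [isLittleO_iff_tendsto' (Filter.mem_of_superset
      (hl (Bornology.eventually_ne_cobounded (0 : ℂ))) fun k hk h => absurd h (by simpa using hk))]
    have h := tendsto_pi_nhds.1 (tendsto_pi_nhds.1
      (tendsto_sq_smul_weylForm_sub_expansion hl hr a) i) j
    refine h.congr' ?_
    filter_upwards [hm a] with k hk
    rw [hk]
    simp [mul_comm]
  · rw [isLittleO_one_iff]
    have h := tendsto_pi_nhds.1 (tendsto_pi_nhds.1 (tendsto_weylForm_infty_sub hr) i) j
    refine h.congr' ?_
    filter_upwards [hm ∞] with k hk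
    rw [hk]
    rfl
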